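/- Let $\mathbb{D}$ be the unit disc with its Poincaré distance $d_P$, so $d_P(0,\xi)=\ln\frac{1+|\xi|}{1-|\xi|}$. For $i\in\{1,2\}$ let $\Gamma_i\subset\mathrm{Aut}(\mathbb{D})$ be a Fuchsian group acting freely on $\mathbb{D}$ with compact quotient $\Sigma_i=\mathbb{D}/\Gamma_i$; thus $\Sigma_i$ is a compact hyperbolic Riemann surface, and $\Gamma_i$ is identified with $\pi_1(\Sigma_i)$ acting by deck transformations. Let $T_i$ be a compact metric space and $\rho_i\colon\Gamma_i\to\mathrm{Homeo}(T_i)$ a representation. The suspension $\mathcal{F}_i$ of $\rho_i$ is the space $X_i=(\mathbb{D}\times T_i)/\Gamma_i$, the quotient by the diagonal action $\gamma\cdot(z,t)=(\gamma z,\rho_i(\gamma)t)$, laminated by the images $[\mathbb{D}\times\{t\}]$, $t\in T_i$. Fix on $X_i$ any distance $d_{X_i}$ inducing its topology (for example the one coming from an embedding of $X_i$ in a Riemannian manifold). For $x\in X_i$ choose a uniformization $\phi_x$ of the leaf through $x$ with $\phi_x(0)=x$, that is, $\phi_x(\xi)=[\tau(\xi),t]$ for some $t\in T_i$ and $\tau\in\mathrm{Aut}(\mathbb{D})$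 with $[\tau(0),t]=x$. For $R>0$ put \[d_R(x,y)=\inf_{\theta\in\mathbb{R}}\ \sup_{d_P(0,\xi)\le R} d_{X_i}\big(\phi_x(\xi),\phi_y(e^{i\theta}\xi)\big),\] let $N(R,\varepsilon)$ be the minimal number of sets $\{y\in X_i : d_R(x,y)<\varepsilon\}$, $x\in X_i$, needed to cover $X_i$, and let \[h(\mathcal{F}_i)=\sup_{\varepsilon>0}\ \limsup_{R\to+\infty}\frac1R\log N(R,\varepsilon)\] be the hyperbolic entropy of $\mathcal{F}_i$. Let $\Phi\colon\Sigma_1\to\Sigma_2$ be a homeomorphism inducing an isomorphism $\varphi\colon\Gamma_1\to\Gamma_2$ (i.e. $\Phi$ has a lift $\widetilde\Phi\colon\mathbb{D}\to\mathbb{D}$ with $\widetilde\Phi\circ\gamma=\varphi(\gamma)\circ\widetilde\Phi$ for all $\gamma\in\Gamma_1$), and let $\Psi\colon T_1\to T_2$ be a homeomorphism such that \[\rho_2(\gamma)=\Psi\circ\rho_1(\varphi^{-1}(\gamma))\circ\Psi^{-1}\qquad\text{for all }\gamma\in\Gamma_2.\] Then $h(\mathcal{F}_1)=2$ if and only if $h(\mathcal{F}_2)=2$,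 and $h(\mathcal{F}_1)=+\infty$ if and only if $h(\mathcal{F}_2)=+\infty$. -/

import Mathlib

open Set Filter Topology
open scoped ENNReal Complex.UnitDisc

namespace HypSusp

/-! ### The unit disc and its automorphisms -/

/-- A self-map of the unit disc is holomorphic. -/
def IsHolomorphic (g : 𝔻 → 𝔻) : Prop :=
  ∃ f : ℂ → ℂ, DifferentiableOn ℂ f (Metric.ball 0 1) ∧ ∀ z : 𝔻, (g z : ℂ) = f z

theorem IsHolomorphic.id : IsHolomorphic (fun z => z) :=
  ⟨fun z => z, differentiableOn_id, fun _ => rfl⟩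

theorem IsHolomorphic.comp {g h : 𝔻 → 𝔻} (hg : IsHolomorphic g) (hh : IsHolomorphic h) :
    IsHolomorphic (fun z => g (h z)) := by
  obtain ⟨f, hf, hfg⟩ := hg
  obtain ⟨k, hk, hkh⟩ := hh
  refine ⟨fun z => f (k z), hf.comp hk ?_, fun z => by rw [hfg, hkh]⟩
  intro z hz
  have hz' : ‖z‖ < 1 := by simpa using hz
  have := hkh (Complex.UnitDisc.mk z hz')
  rw [Complex.UnitDisc.coe_mk] at this
  rw [← this]
  simpa using (h (Complex.UnitDisc.mk z hz')).norm_lt_one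

/-- `Aut(𝔻)`, the group of biholomorphisms of the unit disc. -/
def discAut : Subgroup (𝔻 ≃ₜ 𝔻) where
  carrier := {g | IsHolomorphic g ∧ IsHolomorphic g.symm}
  one_mem' := ⟨IsHolomorphic.id, IsHolomorphic.id⟩
  mul_mem' := fun ha hb => ⟨ha.1.comp hb.1, hb.2.comp ha.2⟩
  inv_mem' := fun ha => ⟨ha.2, ha.1⟩

/-- The Poincaré distance from `0` to `ξ` (the metric of curvature `-1`). -/
noncomputable def poincareDistZero (ξ : 𝔻) : ℝ :=
  Real.log ((1 + ‖(ξ : ℂ)‖) / (1 - ‖(ξ : ℂ)‖))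

/-- The closed disc of centre `0` and hyperbolic radius `R`. -/
def closedHypDisc (R : ℝ) : Set 𝔻 := {ξ | poincareDistZero ξ ≤ R}

/-! ### Compact hyperbolic surfaces -/

/-- The points of `Σ = 𝔻 / Γ`. -/
def surfaceSetoid (Γ : Subgroup (𝔻 ≃ₜ 𝔻)) : Setoid 𝔻 where
  r z w := ∃ γ : Γ, w = (γ : 𝔻 ≃ₜ 𝔻) z
  iseqv :=
    ⟨fun _ => ⟨1, rfl⟩,
     fun {z w} ⟨γ, h⟩ => ⟨γ⁻¹, by
        subst h; exact ((γ : 𝔻 ≃ₜ 𝔻).symm_apply_apply z).symm⟩,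
     fun {_ _ _} ⟨γ, h⟩ ⟨γ', h'⟩ => ⟨γ' * γ, by subst h; exact h'⟩⟩

/-- The quotient surface `Σ = 𝔻 / Γ`, with the quotient topology. -/
abbrev Surface (Γ : Subgroup (𝔻 ≃ₜ 𝔻)) : Type := Quotient (surfaceSetoid Γ)

/-- The projection `𝔻 → Σ = 𝔻 / Γ`. -/
def Surface.mk (Γ : Subgroup (𝔻 ≃ₜ 𝔻)) (z : 𝔻) : Surface Γ := Quotient.mk (surfaceSetoid Γ) z

/-- `Γ` is a Fuchsian group, `𝔻 / Γ` is smooth (no nontrivial element of `Γ` has a fixed point)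
and compact. In other words `𝔻 → 𝔻 / Γ` is the uniformization of a compact Riemann surface of
genus at least two, and `Γ` is the fundamental group of this surface, acting by deck
transformations. -/
structure IsSurfaceGroup (Γ : Subgroup (𝔻 ≃ₜ 𝔻)) : Prop where
  le_discAut : Γ ≤ discAut
  properlyDiscontinuous : ∀ K : Set 𝔻, IsCompact K →
    {γ : 𝔻 ≃ₜ 𝔻 | γ ∈ Γ ∧ (γ '' K ∩ K).Nonempty}.Finite
  free : ∀ γ ∈ Γ, γ ≠ 1 → ∀ z : 𝔻, γ z ≠ z
  compact : CompactSpace (Surface Γ)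

/-- The homeomorphism `Φ : Σ₁ → Σ₂` induces the isomorphism `φ : Γ₁ → Γ₂` of fundamental groups:
some lift `F` of `Φ` to the universal covers satisfies `F ∘ γ = φ(γ) ∘ F` for all `γ`. -/
def Induces {Γ₁ Γ₂ : Subgroup (𝔻 ≃ₜ 𝔻)} (Φ : Surface Γ₁ ≃ₜ Surface Γ₂) (φ : Γ₁ ≃* Γ₂) : Prop :=
  ∃ F : 𝔻 ≃ₜ 𝔻, (∀ z, Φ (Surface.mk Γ₁ z) = Surface.mk Γ₂ (F z)) ∧
    ∀ (γ : Γ₁) (z : 𝔻), F ((γ : 𝔻 ≃ₜ 𝔻) z) = (φ γ : 𝔻 ≃ₜ 𝔻) (F z)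

/-! ### Suspensions -/

section Suspension

variable {Γ : Subgroup (𝔻 ≃ₜ 𝔻)} {T : Type*} [TopologicalSpace T]

/-- The orbit relation of the diagonal action `γ · (z, t) = (γ z, ρ(γ) t)` on `𝔻 × T`. -/
def suspensionSetoid (ρ : Γ →* (T ≃ₜ T)) : Setoid (𝔻 × T) where
  r p q := ∃ γ : Γ, q = ((γ : 𝔻 ≃ₜ 𝔻) p.1, ρ γ p.2)
  iseqv :=
    ⟨fun p => ⟨1, by rw [map_one]; rfl⟩,
     fun {p q} ⟨γ, h⟩ => ⟨γ⁻¹, by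
        subst h; rw [map_inv]
        exact Prod.ext ((γ : 𝔻 ≃ₜ 𝔻).symm_apply_apply p.1).symm
          ((ρ γ).symm_apply_apply p.2).symm⟩,
     fun {_ _ _} ⟨γ, h⟩ ⟨γ', h'⟩ => ⟨γ' * γ, by subst h; rw [map_mul]; exact h'⟩⟩

/-- The suspension space `X = (𝔻 × T) / Γ`, with the quotient topology. -/
abbrev Suspension (ρ : Γ →* (T ≃ₜ T)) := Quotient (suspensionSetoid ρ)

/-- The class `[z, t]`. For fixed `t`, the map `z ↦ [z, t]` uniformizes the leaf `[𝔻 × {t}]`. -/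
def Suspension.mk (ρ : Γ →* (T ≃ₜ T)) (z : 𝔻) (t : T) : Suspension ρ :=
  Quotient.mk (suspensionSetoid ρ) (z, t)

/-- `f : 𝔻 → X` is a uniformization, with `f 0 = x`, of the leaf through `x`. The uniformizations
of the leaf `[𝔻 × {t}]` are the maps `ξ ↦ [τ ξ, t]`, with `τ ∈ Aut(𝔻)`. -/
def IsLeafUniformization (ρ : Γ →* (T ≃ₜ T)) (x : Suspension ρ) (f : 𝔻 → Suspension ρ) : Prop :=
  f 0 = x ∧ ∃ t : T, ∃ τ ∈ discAut, ∀ ξ : 𝔻, f ξ = Suspension.mk ρ (τ ξ) t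

end Suspension

/-! ### Hyperbolic entropy -/

section Entropy

variable {X M : Type*} [MetricSpace M]

/-- The Bowen distance `d_R`, where `d_X` is the distance of `M` pulled back by `ι : X → M`
and `u x` is a uniformization, mapping `0` to `x`, of the leaf through `x`. -/
noncomputable def bowenDist (ι : X → M) (u : X → 𝔻 → X) (R : ℝ) (x y : X) : ℝ≥0∞ :=
  ⨅ θ : ℝ, ⨆ ξ ∈ closedHypDisc R, edist (ι (u x ξ)) (ι (u y (Circle.exp θ • ξ)))

/-- The Bowen ball `B_R(x, ε)`. -/
def bowenBall (ι : X → M) (u : X → 𝔻 → X) (R : ℝ) (x : X) (ε : ℝ) : Set X :=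
  {y | bowenDist ι u R x y < ENNReal.ofReal ε}

/-- `N(Y, R, ε)`: the minimal number of Bowen balls `B_R(x, ε)`, `x ∈ X`, covering `Y`. -/
noncomputable def coveringNumber (ι : X → M) (u : X → 𝔻 → X) (Y : Set X) (R ε : ℝ) : ℕ∞ :=
  ⨅ (F : Finset X) (_ : Y ⊆ ⋃ x ∈ F, bowenBall ι u R x ε), (F.card : ℕ∞)

/-- The hyperbolic entropy `h(Y) = sup_{ε > 0} limsup_{R → ∞} (1/R) log N(Y, R, ε)`. -/
noncomputable def entropyOn (ι : X → M) (u : X → 𝔻 → X) (Y : Set X) : EReal :=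
  ⨆ (ε : ℝ) (_ : 0 < ε), limsup (fun R : ℝ =>
    ENNReal.log (coveringNumber ι u Y R ε : ℝ≥0∞) / (R : EReal)) atTop

/-- The hyperbolic entropy of the whole lamination. -/
noncomputable def hyperbolicEntropy (ι : X → M) (u : X → 𝔻 → X) : EReal := entropyOn ι u univ

end Entropy

end HypSusp

open HypSusp

open ComplexConjugate

namespace HypSusp

/-! ### Möbius transformations and the hyperbolic distance -/

/-! The entropy of a suspension over a nonempty `T` is 2 plus the exponential growth rate, in `R`,
of the number of points of `T` separated by those `γ` with `d_P(0, γ 0) ≤ R`. Neither the distance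
on the suspension nor the choice of uniformizations enters this rate;
`hyperbolicEntropy_le_iff_transGrowth` makes it precise.

The 2 comes from the leaf direction. Up to a rotation of the source, two automorphisms stay close on
the disc of radius `R` once their values at `0` are within a small multiple of `exp (-R)`
(`exists_rotation_forall_norm_le`); conversely, closeness on that disc forces values within `8 * exp
(-R)` (`norm_sub_le_of_forall_hypDist_le`). A bounded region of real dimension two therefore
contributes about `exp (2 * R)` base points.

The transverse factor comes from lifting to `𝔻 × T`. A leaf disc of radius `R` meets, up to bounded
error, the translates of a fundamental domain by the `γ` displacing `0` by at most `R`, and in each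
one closeness in the suspension is closeness of `ρ γ s` and `ρ γ t`. The two counts are
`exists_cover_card_le` and `exists_le_card_cover`.

An equivariant lift of `Φ` distorts displacements at most linearly, in both directions, and `Ψ` is
uniformly bicontinuous. A rate bound `a` on one side thus gives a bound `L * a` on the other
(`exists_transGrowth_of_conj`). The exact rate need not survive, but rate zero and infinite rate do.
-/

theorem one_add_conj_mul_ne_zero (a z : 𝔻) : 1 + conj (a : ℂ) * z ≠ 0 := by
  intro h
  have h1 : ‖conj (a : ℂ) * z‖ = 1 := by
    rw [eq_neg_of_add_eq_zero_right h]; simp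
  rw [norm_mul, Complex.norm_conj] at h1
  nlinarith [a.norm_lt_one, z.norm_lt_one, norm_nonneg (a : ℂ), norm_nonneg (z : ℂ)]

theorem normSq_one_add_sub (a z : ℂ) :
    Complex.normSq (1 + conj a * z) - Complex.normSq (z + a) =
      (1 - Complex.normSq a) * (1 - Complex.normSq z) := by
  simp only [Complex.normSq_apply, Complex.add_re, Complex.add_im, Complex.mul_re, Complex.mul_im,
    Complex.conj_re, Complex.conj_im, Complex.one_re, Complex.one_im]
  ring

theorem norm_mob_lt_one (a z : 𝔻) : ‖((z : ℂ) + a) / (1 + conj (a : ℂ) * z)‖ < 1 := by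
  rw [norm_div, div_lt_one (norm_pos_iff.2 (one_add_conj_mul_ne_zero a z))]
  have h := normSq_one_add_sub (a : ℂ) z
  have h1 : 0 < (1 - Complex.normSq a) * (1 - Complex.normSq z) :=
    mul_pos (by linarith [a.normSq_lt_one]) (by linarith [z.normSq_lt_one])
  rw [Complex.normSq_eq_norm_sq, Complex.normSq_eq_norm_sq] at h
  exact lt_of_pow_lt_pow_left₀ 2 (norm_nonneg _) (by linarith)

/-- The Möbius transformation `z ↦ (z + a) / (1 + ā z)`. -/
noncomputable def mob (a z : 𝔻) : 𝔻 :=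
  Complex.UnitDisc.mk (((z : ℂ) + a) / (1 + conj (a : ℂ) * z)) (norm_mob_lt_one a z)

theorem coe_mob (a z : 𝔻) : (mob a z : ℂ) = ((z : ℂ) + a) / (1 + conj (a : ℂ) * z) := rfl

theorem mob_zero (a : 𝔻) : mob a 0 = a := by
  apply Complex.UnitDisc.coe_injective
  simp [coe_mob]

theorem mob_neg_self (a : 𝔻) : mob (-a) a = 0 := by
  apply Complex.UnitDisc.coe_injective
  simp [coe_mob]

theorem mob_neg_mob (a z : 𝔻) : mob (-a) (mob a z) = z := by
  apply Complex.UnitDisc.coe_injective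
  have h1 : (mob a z : ℂ) * (1 + conj (a : ℂ) * z) = z + a :=
    div_mul_cancel₀ _ (one_add_conj_mul_ne_zero a z)
  rw [coe_mob, div_eq_iff (one_add_conj_mul_ne_zero (-a) (mob a z)), Complex.UnitDisc.coe_neg,
    map_neg]
  linear_combination h1

theorem continuous_mob_uncurry : Continuous fun p : 𝔻 × 𝔻 => mob p.1 p.2 := by
  rw [Complex.UnitDisc.isEmbedding_coe.continuous_iff]
  refine Continuous.div ?_ ?_ fun p => one_add_conj_mul_ne_zero p.1 p.2
  · exact (Complex.UnitDisc.continuous_coe.comp continuous_snd).add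
      (Complex.UnitDisc.continuous_coe.comp continuous_fst)
  · exact continuous_const.add ((Complex.continuous_conj.comp
      (Complex.UnitDisc.continuous_coe.comp continuous_fst)).mul
      (Complex.UnitDisc.continuous_coe.comp continuous_snd))

theorem continuous_mob (a : 𝔻) : Continuous (mob a) :=
  continuous_mob_uncurry.comp (continuous_const.prodMk continuous_id)

/-- `mob a` as a homeomorphism of the disc. -/
noncomputable def mobHomeo (a : 𝔻) : 𝔻 ≃ₜ 𝔻 where
  toFun := mob a
  invFun := mob (-a)
  left_inv := mob_neg_mob a
  right_inv z := by simpa using mob_neg_mob (-a) z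
  continuous_toFun := continuous_mob a
  continuous_invFun := continuous_mob (-a)

theorem isHolomorphic_mob (a : 𝔻) : IsHolomorphic (mob a) := by
  refine ⟨fun z => (z + a) / (1 + conj (a : ℂ) * z), ?_, fun z => coe_mob a z⟩
  refine DifferentiableOn.div (by fun_prop) (by fun_prop) fun z hz => ?_
  exact one_add_conj_mul_ne_zero a (Complex.UnitDisc.mk z (by simpa using hz))

theorem mobHomeo_mem (a : 𝔻) : mobHomeo a ∈ discAut :=
  ⟨isHolomorphic_mob a, isHolomorphic_mob (-a)⟩

/-- The rotation `z ↦ c z`. -/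
noncomputable def rot (c : Circle) : 𝔻 ≃ₜ 𝔻 where
  toFun z := c • z
  invFun z := c⁻¹ • z
  left_inv z := inv_smul_smul c z
  right_inv z := smul_inv_smul c z
  continuous_toFun := by
    rw [Complex.UnitDisc.isEmbedding_coe.continuous_iff]
    exact continuous_const.mul Complex.UnitDisc.continuous_coe
  continuous_invFun := by
    rw [Complex.UnitDisc.isEmbedding_coe.continuous_iff]
    exact continuous_const.mul Complex.UnitDisc.continuous_coe

theorem isHolomorphic_rot (c : Circle) : IsHolomorphic fun z => c • z :=
  ⟨fun z => c * z, by fun_prop, fun z => Complex.UnitDisc.coe_circle_smul c z⟩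

theorem rot_mem (c : Circle) : rot c ∈ discAut := ⟨isHolomorphic_rot c, isHolomorphic_rot c⁻¹⟩

/-- This is the Schwarz lemma; applied to an automorphism and to its inverse it yields
`norm_apply_of_apply_zero`. -/
theorem IsHolomorphic.norm_le {g : 𝔻 → 𝔻} (hg : IsHolomorphic g) (h0 : g 0 = 0) (z : 𝔻) :
    ‖(g z : ℂ)‖ ≤ ‖(z : ℂ)‖ := by
  obtain ⟨f, hf, hfg⟩ := hg
  rw [hfg]
  refine Complex.norm_le_norm_of_mapsTo_ball hf (fun w hw => ?_) ?_ z.norm_lt_one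
  · have := hfg (Complex.UnitDisc.mk w (by simpa using hw))
    rw [Complex.UnitDisc.coe_mk] at this
    rw [← this]
    simpa using (Complex.UnitDisc.norm_lt_one _).le
  · have := hfg 0
    rw [h0] at this
    simpa using this.symm

theorem norm_apply_of_apply_zero {σ : 𝔻 ≃ₜ 𝔻} (hσ : σ ∈ discAut) (h0 : σ 0 = 0) (z : 𝔻) :
    ‖(σ z : ℂ)‖ = ‖(z : ℂ)‖ := by
  refine le_antisymm (hσ.1.norm_le h0 z) ?_
  have h1 : σ.symm 0 = 0 := by rw [σ.symm_apply_eq, h0]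
  simpa using hσ.2.norm_le h1 (σ z)

theorem exists_rotation_of_apply_zero {σ : 𝔻 ≃ₜ 𝔻} (hσ : σ ∈ discAut) (h0 : σ 0 = 0) :
    ∃ c : Circle, ∀ z : 𝔻, σ z = c • z := by
  obtain ⟨f, hf, hfσ⟩ := hσ.1
  have hf0 : f 0 = 0 := by simpa [h0] using (hfσ 0).symm
  have hn : ∀ z : ℂ, ‖z‖ < 1 → ‖f z‖ = ‖z‖ := fun z hz => by
    simpa [hfσ] using norm_apply_of_apply_zero hσ h0 (Complex.UnitDisc.mk z hz)
  have hmaps : MapsTo f (Metric.ball 0 1) (Metric.closedBall (f 0) 1) := fun z hz => by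
    have hz' : ‖z‖ < 1 := by simpa using hz
    rw [hf0, mem_closedBall_zero_iff, hn z hz']
    exact hz'.le
  -- Equality in the Schwarz lemma at a single nonzero point, here `1 / 2`, forces a rotation.
  have hslope : ‖dslope f 0 (1 / 2)‖ = 1 / 1 := by
    have h2 : ‖f (1 / 2)‖ = 1 / 2 := by rw [hn _ (by norm_num)]; norm_num
    rw [dslope_of_ne _ (by norm_num), slope_def_module, norm_smul, hf0, sub_zero, sub_zero, h2]
    norm_num
  obtain ⟨C, hC, hC'⟩ := Complex.affine_of_mapsTo_ball_of_exists_norm_dslope_eq_div' hf hmaps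
    ⟨1 / 2, by norm_num, hslope⟩
  have hmem : C ∈ Submonoid.unitSphere ℂ := mem_sphere_zero_iff_norm.2 (by simpa using hC)
  refine ⟨⟨C, hmem⟩, fun z => Complex.UnitDisc.coe_injective ?_⟩
  have h : f z = f 0 + ((z : ℂ) - 0) • C :=
    hC' (show (z : ℂ) ∈ Metric.ball 0 1 by simpa using z.norm_lt_one)
  rw [hf0, sub_zero, zero_add, smul_eq_mul, mul_comm] at h
  rw [hfσ, h]
  rfl

theorem poincareDistZero_congr {z w : 𝔻} (h : ‖(z : ℂ)‖ = ‖(w : ℂ)‖) :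
    poincareDistZero z = poincareDistZero w := by
  rw [poincareDistZero, poincareDistZero, h]

theorem exp_poincareDistZero (z : 𝔻) :
    Real.exp (poincareDistZero z) = (1 + ‖(z : ℂ)‖) / (1 - ‖(z : ℂ)‖) :=
  Real.exp_log (div_pos (by positivity) (by linarith [z.norm_lt_one]))

theorem poincareDistZero_le_iff {z : 𝔻} {R : ℝ} :
    poincareDistZero z ≤ R ↔ 1 + ‖(z : ℂ)‖ ≤ Real.exp R * (1 - ‖(z : ℂ)‖) := by
  rw [← Real.exp_le_exp, exp_poincareDistZero, div_le_iff₀ (by linarith [z.norm_lt_one])]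

theorem poincareDistZero_mono {z w : 𝔻} (h : ‖(z : ℂ)‖ ≤ ‖(w : ℂ)‖) :
    poincareDistZero z ≤ poincareDistZero w := by
  rw [poincareDistZero_le_iff, exp_poincareDistZero, div_mul_eq_mul_div,
    le_div_iff₀ (by linarith [w.norm_lt_one])]
  nlinarith

theorem poincareDistZero_zero : poincareDistZero 0 = 0 := by simp [poincareDistZero]

theorem poincareDistZero_nonneg (z : 𝔻) : 0 ≤ poincareDistZero z := by
  rw [← poincareDistZero_zero]
  exact poincareDistZero_mono (by simp)

theorem poincareDistZero_eq_zero {z : 𝔻} (h : poincareDistZero z = 0) : z = 0 := by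
  have h1 := poincareDistZero_le_iff.1 h.le
  rw [Real.exp_zero] at h1
  have h2 : ‖(z : ℂ)‖ = 0 := by linarith [norm_nonneg (z : ℂ)]
  simpa using h2

theorem continuous_poincareDistZero : Continuous poincareDistZero := by
  have hc : Continuous fun z : 𝔻 => ‖(z : ℂ)‖ := Complex.UnitDisc.continuous_coe.norm
  have h1 : ∀ z : 𝔻, 1 - ‖(z : ℂ)‖ ≠ 0 := fun z => by linarith [z.norm_lt_one]
  refine Continuous.log ((continuous_const.add hc).div (continuous_const.sub hc) h1) fun z => ?_
  exact div_ne_zero (by positivity) (h1 z)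

theorem poincareDistZero_le_four_mul {z : 𝔻} (h : ‖(z : ℂ)‖ ≤ 1 / 2) :
    poincareDistZero z ≤ 4 * ‖(z : ℂ)‖ := by
  rw [poincareDistZero_le_iff]
  have := Real.add_one_le_exp (4 * ‖(z : ℂ)‖)
  nlinarith [norm_nonneg (z : ℂ)]

theorem norm_le_half_of_poincareDistZero_le {z : 𝔻} (h : poincareDistZero z ≤ 1) :
    ‖(z : ℂ)‖ ≤ 1 / 2 := by
  have h1 := poincareDistZero_le_iff.1 h
  have h2 : Real.exp 1 < 3 := by linarith [Real.exp_one_lt_d9]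
  nlinarith [z.norm_lt_one]

/-- The hyperbolic distance of the unit disc. -/
noncomputable def hypDist (z w : 𝔻) : ℝ := poincareDistZero (mob (-z) w)

theorem norm_mob_neg (z w : 𝔻) :
    ‖(mob (-z) w : ℂ)‖ = ‖(w : ℂ) - z‖ / ‖1 - conj (z : ℂ) * w‖ := by
  rw [coe_mob, norm_div]
  simp [sub_eq_add_neg]

theorem hypDist_comm (z w : 𝔻) : hypDist z w = hypDist w z := by
  apply poincareDistZero_congr
  rw [norm_mob_neg, norm_mob_neg, norm_sub_rev, ← Complex.norm_conj (1 - conj (z : ℂ) * w)]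
  simp [mul_comm]

theorem hypDist_zero_left (z : 𝔻) : hypDist 0 z = poincareDistZero z :=
  poincareDistZero_congr (by rw [norm_mob_neg]; simp)

theorem hypDist_zero_right (z : 𝔻) : hypDist z 0 = poincareDistZero z := by
  rw [hypDist_comm, hypDist_zero_left]

theorem hypDist_nonneg (z w : 𝔻) : 0 ≤ hypDist z w := poincareDistZero_nonneg _

theorem hypDist_self (z : 𝔻) : hypDist z z = 0 := by
  rw [hypDist, mob_neg_self, poincareDistZero_zero]

theorem eq_of_hypDist_eq_zero {z w : 𝔻} (h : hypDist z w = 0) : z = w := by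
  have h1 : mobHomeo (-z) w = mobHomeo (-z) z :=
    (poincareDistZero_eq_zero h).trans (mob_neg_self z).symm
  exact ((mobHomeo (-z)).injective h1).symm

theorem continuous_hypDist : Continuous fun p : 𝔻 × 𝔻 => hypDist p.1 p.2 := by
  have hneg : Continuous fun z : 𝔻 => -z := by
    rw [Complex.UnitDisc.isEmbedding_coe.continuous_iff]
    exact Complex.UnitDisc.continuous_coe.neg
  exact continuous_poincareDistZero.comp (continuous_mob_uncurry.comp
    ((hneg.comp continuous_fst).prodMk continuous_snd))

theorem continuous_hypDist_apply {Y : Type*} [TopologicalSpace Y] {f g : Y → 𝔻}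
    (hf : Continuous f) (hg : Continuous g) : Continuous fun y => hypDist (f y) (g y) :=
  continuous_hypDist.comp₂ hf hg

/-- Composing with Möbius maps that carry `0` to `z` and `τ z` to `0` gives an automorphism fixing
`0`, which preserves the norm. -/
theorem hypDist_map {τ : 𝔻 ≃ₜ 𝔻} (hτ : τ ∈ discAut) (z w : 𝔻) :
    hypDist (τ z) (τ w) = hypDist z w := by
  have hmem : mobHomeo (-(τ z)) * τ * mobHomeo z ∈ discAut :=
    mul_mem (mul_mem (mobHomeo_mem _) hτ) (mobHomeo_mem _)
  have h0 : (mobHomeo (-(τ z)) * τ * mobHomeo z) 0 = 0 := by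
    change mob (-(τ z)) (τ (mob z 0)) = 0
    rw [mob_zero, mob_neg_self]
  have h1 := norm_apply_of_apply_zero hmem h0 (mob (-z) w)
  refine poincareDistZero_congr ?_
  rw [← h1]
  change _ = ‖((mob (-(τ z)) (τ (mob z (mob (-z) w))) : 𝔻) : ℂ)‖
  rw [show mob z (mob (-z) w) = w by simpa using mob_neg_mob (-z) w]

/-- With `A`, `B` the norms of denominator and numerator, `B² = A² - (1 - |z|²)(1 - |w|²)`, so `B /
A` increases with `A`, and `A ≤ 1 + |z||w|`. The bound is the addition law of hyperbolic lengths,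
hence the triangle inequality through `0`. -/
theorem norm_mob_neg_le (z w : 𝔻) :
    ‖(mob (-z) w : ℂ)‖ ≤ (‖(z : ℂ)‖ + ‖(w : ℂ)‖) / (1 + ‖(z : ℂ)‖ * ‖(w : ℂ)‖) := by
  have hz := z.norm_lt_one
  have hw := w.norm_lt_one
  have hz0 := norm_nonneg (z : ℂ)
  have hw0 := norm_nonneg (w : ℂ)
  have h := normSq_one_add_sub (-z : ℂ) w
  have hne := norm_pos_iff.2 (one_add_conj_mul_ne_zero (-z) w)
  rw [coe_mob, norm_div, div_le_div_iff₀ hne (by positivity)]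
  rw [Complex.UnitDisc.coe_neg] at *
  simp only [Complex.normSq_eq_norm_sq, norm_neg] at h
  have hle : ‖1 + conj (-z : ℂ) * w‖ ≤ 1 + ‖(z : ℂ)‖ * ‖(w : ℂ)‖ := by
    refine (norm_add_le _ _).trans ?_
    simp
  set A := ‖1 + conj (-z : ℂ) * w‖
  set B := ‖(w : ℂ) + -z‖
  set x := ‖(z : ℂ)‖
  set y := ‖(w : ℂ)‖
  have hB : 0 ≤ B := norm_nonneg _
  refine le_of_pow_le_pow_left₀ two_ne_zero (by positivity) ?_
  have hA2 : A ^ 2 ≤ (1 + x * y) ^ 2 := pow_le_pow_left₀ hne.le hle 2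
  have hp : 0 ≤ (1 - x ^ 2) * (1 - y ^ 2) := mul_nonneg (by nlinarith) (by nlinarith)
  have e : (1 + x * y) ^ 2 - (x + y) ^ 2 = (1 - x ^ 2) * (1 - y ^ 2) := by ring
  have hB2 : B ^ 2 = A ^ 2 - (1 - x ^ 2) * (1 - y ^ 2) := by linarith
  rw [mul_pow, mul_pow, hB2]
  nlinarith [mul_nonneg hp (sub_nonneg.2 hA2)]

theorem hypDist_le_add_poincareDistZero (z w : 𝔻) :
    hypDist z w ≤ poincareDistZero z + poincareDistZero w := by
  have hz := z.norm_lt_one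
  have hw := w.norm_lt_one
  have hz0 := norm_nonneg (z : ℂ)
  have hw0 := norm_nonneg (w : ℂ)
  rw [hypDist, poincareDistZero_le_iff, Real.exp_add, exp_poincareDistZero, exp_poincareDistZero,
    div_mul_div_comm, div_mul_eq_mul_div, le_div_iff₀ (mul_pos (by linarith) (by linarith))]
  have h := norm_mob_neg_le z w
  rw [le_div_iff₀ (by positivity)] at h
  nlinarith

theorem hypDist_triangle (a b c : 𝔻) : hypDist a c ≤ hypDist a b + hypDist b c := by
  have h := hypDist_map (mobHomeo_mem (-b)) a c
  rw [← h, hypDist_comm a b]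
  exact hypDist_le_add_poincareDistZero _ _

theorem poincareDistZero_le_add_hypDist (a b : 𝔻) :
    poincareDistZero b ≤ poincareDistZero a + hypDist a b := by
  simpa only [hypDist_zero_left] using hypDist_triangle 0 a b

theorem poincareDistZero_symm_apply {τ : 𝔻 ≃ₜ 𝔻} (hτ : τ ∈ discAut) (z : 𝔻) :
    poincareDistZero (τ.symm z) = hypDist (τ 0) z := by
  rw [← hypDist_zero_left, ← hypDist_map hτ, τ.apply_symm_apply]

/-! ### Hyperbolic discs -/

/-- The Euclidean radius of the disc of hyperbolic radius `R` about `0`. -/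
noncomputable def euclideanRadius (R : ℝ) : ℝ := (Real.exp R - 1) / (Real.exp R + 1)

theorem poincareDistZero_le_iff_norm_le {z : 𝔻} {R : ℝ} :
    poincareDistZero z ≤ R ↔ ‖(z : ℂ)‖ ≤ euclideanRadius R := by
  rw [poincareDistZero_le_iff, euclideanRadius, le_div_iff₀ (by positivity)]
  constructor <;> intro h <;> linarith

theorem euclideanRadius_lt_one (R : ℝ) : euclideanRadius R < 1 := by
  rw [euclideanRadius, div_lt_one (by positivity)]
  linarith

theorem one_sub_euclideanRadius_le (R : ℝ) : 1 - euclideanRadius R ≤ 2 * Real.exp (-R) := by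
  have h : 1 - euclideanRadius R = 2 / (Real.exp R + 1) := by
    rw [euclideanRadius]; field_simp; ring
  rw [h, Real.exp_neg, ← div_eq_mul_inv]
  exact div_le_div_of_nonneg_left (by norm_num) (Real.exp_pos R) (by linarith)

theorem exp_neg_le_one_sub_norm {z : 𝔻} {R : ℝ} (h : poincareDistZero z ≤ R) :
    Real.exp (-R) ≤ 1 - ‖(z : ℂ)‖ := by
  rw [Real.exp_neg, inv_le_iff_one_le_mul₀ (Real.exp_pos R), mul_comm]
  linarith [poincareDistZero_le_iff.1 h, norm_nonneg (z : ℂ)]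

theorem mem_closedHypDisc {z : 𝔻} {R : ℝ} : z ∈ closedHypDisc R ↔ poincareDistZero z ≤ R := Iff.rfl

theorem coe_image_closedHypDisc (R : ℝ) :
    ((↑) : 𝔻 → ℂ) '' closedHypDisc R = Metric.closedBall 0 (euclideanRadius R) := by
  ext z
  rw [mem_closedBall_zero_iff]
  constructor
  · rintro ⟨w, hw, rfl⟩
    exact poincareDistZero_le_iff_norm_le.1 hw
  · intro hz
    exact ⟨Complex.UnitDisc.mk z (hz.trans_lt (euclideanRadius_lt_one R)),
      poincareDistZero_le_iff_norm_le.2 hz, rfl⟩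

theorem isCompact_closedHypDisc (R : ℝ) : IsCompact (closedHypDisc R) := by
  rw [Complex.UnitDisc.isEmbedding_coe.isCompact_iff, coe_image_closedHypDisc]
  exact isCompact_closedBall _ _

theorem isPreconnected_closedHypDisc (R : ℝ) : IsPreconnected (closedHypDisc R) := by
  rw [← Complex.UnitDisc.isEmbedding_coe.isInducing.isPreconnected_image, coe_image_closedHypDisc]
  exact (convex_closedBall _ _).isPreconnected

theorem zero_mem_closedHypDisc {R : ℝ} (hR : 0 ≤ R) : (0 : 𝔻) ∈ closedHypDisc R := by
  exact poincareDistZero_zero.trans_le hR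

/-- A point at distance at most `s + t` from `0` is within `t` of a point at distance at
most `s` from `0`. -/
theorem exists_hypDist_le {s t : ℝ} (hs : 0 ≤ s) (ht : 0 ≤ t) {z : 𝔻}
    (hz : poincareDistZero z ≤ s + t) : ∃ w, poincareDistZero w ≤ s ∧ hypDist w z ≤ t := by
  rcases le_or_gt (poincareDistZero z) s with h | h
  · exact ⟨z, h, by rwa [hypDist_self]⟩
  have hz1 := z.norm_lt_one
  have hz0 := norm_nonneg (z : ℂ)
  set r := euclideanRadius s with hr
  have hr0 : 0 ≤ r := div_nonneg (by linarith [Real.one_le_exp hs]) (by positivity)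
  have hr1 : r < 1 := euclideanRadius_lt_one s
  have hrz : r < ‖(z : ℂ)‖ := by
    by_contra! hc
    exact absurd (poincareDistZero_le_iff_norm_le.2 hc) (not_le.2 h)
  have hzp : 0 < ‖(z : ℂ)‖ := hr0.trans_lt hrz
  have hnorm : ‖((r / ‖(z : ℂ)‖ : ℝ) : ℂ) * z‖ = r := by
    rw [norm_mul, Complex.norm_real, Real.norm_of_nonneg (by positivity)]
    field_simp
  -- The point of norm `r` on the ray from `0` to `z`.
  set w : 𝔻 := Complex.UnitDisc.mk (((r / ‖(z : ℂ)‖ : ℝ) : ℂ) * z) (by rw [hnorm]; exact hr1)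
    with hw
  have hwn : ‖(w : ℂ)‖ = r := hnorm
  have hes : Real.exp s = (1 + r) / (1 - r) := by
    rw [eq_div_iff (by linarith), hr, euclideanRadius]
    field_simp
    ring
  refine ⟨w, poincareDistZero_le_iff_norm_le.2 hwn.le, ?_⟩
  have hp : ‖(mob (-w) z : ℂ)‖ = (‖(z : ℂ)‖ - r) / (1 - r * ‖(z : ℂ)‖) := by
    have e1 : (z : ℂ) - w = ((1 - r / ‖(z : ℂ)‖ : ℝ) : ℂ) * z := by
      rw [hw, Complex.UnitDisc.coe_mk]; push_cast; ring
    have e2 : 1 - conj (w : ℂ) * z = ((1 - r * ‖(z : ℂ)‖ : ℝ) : ℂ) := by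
      rw [hw, Complex.UnitDisc.coe_mk, map_mul, Complex.conj_ofReal, mul_assoc, Complex.conj_mul',
        ← Complex.ofReal_pow, ← Complex.ofReal_mul, ← Complex.ofReal_one, ← Complex.ofReal_sub]
      congr 2
      field_simp
    rw [norm_mob_neg, e1, e2, norm_mul, Complex.norm_real, Complex.norm_real, Real.norm_of_nonneg,
      Real.norm_of_nonneg]
    · congr 1
      field_simp
    · nlinarith
    · rw [sub_nonneg, div_le_one hzp]; exact hrz.le
  have h1 := poincareDistZero_le_iff.1 hz
  rw [Real.exp_add, hes, div_mul_eq_mul_div, div_mul_eq_mul_div, le_div_iff₀ (by linarith)] at h1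
  have hd : 0 < 1 - r * ‖(z : ℂ)‖ := by nlinarith
  rw [hypDist, poincareDistZero_le_iff, hp, one_add_div hd.ne', one_sub_div hd.ne', ← mul_div_assoc]
  refine div_le_div_of_nonneg_right ?_ hd.le
  nlinarith

/-! ### Automorphisms that are close on a large disc -/

/-- An automorphism that moves the points of the disc of radius `R` by at most `1` moves `0` by
an exponentially small amount. -/
theorem norm_apply_zero_le {g : 𝔻 ≃ₜ 𝔻} (hg : g ∈ discAut) {R : ℝ} (hR : 0 ≤ R)
    (h : ∀ ξ ∈ closedHypDisc R, hypDist ξ (g ξ) ≤ 1) : ‖(g 0 : ℂ)‖ ≤ 4 * Real.exp (-R) := by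
  obtain ⟨f, hf, hfg⟩ := hg.1
  set r := euclideanRadius R
  have hr1 : r < 1 := euclideanRadius_lt_one R
  have hr0 : 0 ≤ r := div_nonneg (by linarith [Real.one_le_exp hR]) (by positivity)
  -- On `|z| = r` the hypothesis reads `|f z - z| ≤ |1 - conj z * f z| / 2`. As `1 - conj z * f z =
  -- (1 - r²) - conj z * (f z - z)`, solving gives `|f z - z| ≤ 1 - r² ≤ 4 * exp (-R)`. The maximum
  -- principle carries this to `0`.
  have hbd : ∀ z : ℂ, ‖z‖ = r → ‖f z - z‖ ≤ 4 * Real.exp (-R) := by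
    intro z hz
    set ξ : 𝔻 := Complex.UnitDisc.mk z (hz.trans_lt hr1) with hξ
    have hξz : (ξ : ℂ) = z := rfl
    have hp := norm_le_half_of_poincareDistZero_le
      (h ξ (poincareDistZero_le_iff_norm_le.2 (by rw [hξz, hz])))
    rw [norm_mob_neg, hfg, hξz, div_le_iff₀] at hp
    · have h1 : ‖1 - conj z * f z‖ ≤ (1 - r ^ 2) + r * ‖f z - z‖ := by
        have e : 1 - conj z * f z = ((1 - r ^ 2 : ℝ) : ℂ) - conj z * (f z - z) := by
          rw [mul_sub, Complex.conj_mul', hz]; push_cast; ring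
        rw [e]
        refine (norm_sub_le _ _).trans ?_
        rw [norm_mul, Complex.norm_conj, hz, Complex.norm_real, Real.norm_of_nonneg]
        nlinarith
      have h2 := one_sub_euclideanRadius_le R
      have h3 := norm_nonneg (f z - z)
      nlinarith
    · have := one_add_conj_mul_ne_zero (-ξ) (g ξ)
      rw [hfg, Complex.UnitDisc.coe_neg, hξz] at this
      rw [norm_pos_iff]
      simpa [sub_eq_add_neg] using this
  rw [hfg]
  have hd : DifferentiableOn ℂ (fun z => f z - z) (Metric.ball 0 1) := hf.sub differentiableOn_id
  rcases hr0.eq_or_lt with h0 | h0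
  · simpa using hbd 0 (by simpa using h0)
  have hdc : DiffContOnCl ℂ (fun z => f z - z) (Metric.ball 0 r) := by
    refine DifferentiableOn.diffContOnCl (hd.mono ?_)
    rw [closure_ball _ h0.ne']
    exact Metric.closedBall_subset_ball hr1
  have := Complex.norm_le_of_forall_mem_frontier_norm_le (C := 4 * Real.exp (-R))
    Metric.isBounded_ball hdc (fun z hz => hbd z ?_) (subset_closure (Metric.mem_ball_self h0))
  · simpa using this
  · rw [frontier_ball _ h0.ne'] at hz
    simpa using hz

theorem norm_sub_le_of_forall_hypDist_le {σ τ : 𝔻 ≃ₜ 𝔻} (hσ : σ ∈ discAut) (hτ : τ ∈ discAut)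
    {R : ℝ} (hR : 0 ≤ R) (h : ∀ ξ ∈ closedHypDisc R, hypDist (σ ξ) (τ ξ) ≤ 1) :
    ‖(σ 0 : ℂ) - τ 0‖ ≤ 8 * Real.exp (-R) := by
  have hg : σ⁻¹ * τ ∈ discAut := mul_mem (inv_mem hσ) hτ
  have hgσ : ∀ ξ, σ ((σ⁻¹ * τ) ξ) = τ ξ := fun ξ => σ.apply_symm_apply _
  have h1 := norm_apply_zero_le hg hR fun ξ hξ => by
    rw [← hypDist_map hσ, hgσ]; exact h ξ hξ
  have h2 : hypDist (σ 0) (τ 0) = poincareDistZero ((σ⁻¹ * τ) 0) := by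
    rw [← hypDist_zero_left, ← hypDist_map hσ 0, hgσ]
  have h3 : ‖(mob (-(σ 0)) (τ 0) : ℂ)‖ ≤ ‖((σ⁻¹ * τ) 0 : ℂ)‖ := by
    by_contra! hc
    have h4 := exp_poincareDistZero ((σ⁻¹ * τ) 0)
    rw [← h2, hypDist, exp_poincareDistZero, div_eq_div_iff] at h4
    · linarith
    · linarith [(mob (-(σ 0)) (τ 0)).norm_lt_one]
    · linarith [((σ⁻¹ * τ) 0).norm_lt_one]
  rw [norm_mob_neg, div_le_iff₀] at h3
  · have h5 : ‖1 - conj (σ 0 : ℂ) * τ 0‖ ≤ 2 := by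
      refine (norm_sub_le _ _).trans ?_
      rw [norm_mul, Complex.norm_conj, norm_one]
      nlinarith [(σ 0).norm_lt_one, (τ 0).norm_lt_one, norm_nonneg (σ 0 : ℂ),
        norm_nonneg (τ 0 : ℂ)]
    rw [norm_sub_rev]
    nlinarith [norm_nonneg ((σ⁻¹ * τ) 0 : ℂ)]
  · have := one_add_conj_mul_ne_zero (-(σ 0)) (τ 0)
    rw [Complex.UnitDisc.coe_neg] at this
    rw [norm_pos_iff]
    simpa [sub_eq_add_neg] using this

/-- After cancelling `1 + conj a * ξ`, the numerator is at most `2|a|`. The term `conj a * ξ - conj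
ξ * a` in the denominator is purely imaginary, so the real part `1 - |ξ|² ≥ exp (-R)` bounds it
below. -/
theorem norm_mob_neg_mob_le (a ξ : 𝔻) {R : ℝ} (hξ : ξ ∈ closedHypDisc R) :
    ‖(mob (-ξ) (mob a ξ) : ℂ)‖ ≤ 2 * ‖(a : ℂ)‖ * Real.exp R := by
  have hd := one_add_conj_mul_ne_zero a ξ
  have hx := exp_neg_le_one_sub_norm hξ
  have hx1 := ξ.norm_lt_one
  have hx0 := norm_nonneg (ξ : ℂ)
  have e1 : (mob a ξ : ℂ) - ξ = (a - conj (a : ℂ) * ξ ^ 2) / (1 + conj (a : ℂ) * ξ) := by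
    rw [coe_mob, eq_div_iff hd, sub_mul, div_mul_cancel₀ _ hd]; ring
  have e2 : 1 - conj (ξ : ℂ) * mob a ξ =
      (1 - conj (ξ : ℂ) * ξ + (conj (a : ℂ) * ξ - conj (ξ : ℂ) * a)) / (1 + conj (a : ℂ) * ξ) := by
    rw [coe_mob, eq_div_iff hd, sub_mul, mul_assoc, div_mul_cancel₀ _ hd]; ring
  have h1 : ‖(a : ℂ) - conj (a : ℂ) * ξ ^ 2‖ ≤ 2 * ‖(a : ℂ)‖ := by
    refine (norm_sub_le _ _).trans ?_
    rw [norm_mul, norm_pow, Complex.norm_conj]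
    nlinarith [norm_nonneg (a : ℂ), mul_nonneg (norm_nonneg (a : ℂ)) (sub_nonneg.2 hx1.le)]
  have h2 : 1 - ‖(ξ : ℂ)‖ ^ 2 ≤
      ‖1 - conj (ξ : ℂ) * ξ + (conj (a : ℂ) * ξ - conj (ξ : ℂ) * a)‖ := by
    refine le_trans (le_of_eq ?_) (Complex.re_le_norm _)
    rw [Complex.conj_mul', ← Complex.ofReal_pow]
    simp only [Complex.add_re, Complex.sub_re, Complex.one_re, Complex.ofReal_re, Complex.mul_re,
      Complex.conj_re, Complex.conj_im]
    ring
  have h3 : Real.exp (-R) ≤ 1 - ‖(ξ : ℂ)‖ ^ 2 := by nlinarith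
  rw [norm_mob_neg, e1, e2, norm_div, norm_div, div_div_div_cancel_right₀ (norm_ne_zero_iff.2 hd),
    div_le_iff₀ (by linarith [Real.exp_pos (-R)])]
  refine h1.trans ?_
  rw [mul_assoc]
  refine le_mul_of_one_le_right (by positivity) ?_
  have h4 : Real.exp R * Real.exp (-R) = 1 := by rw [← Real.exp_add]; simp
  nlinarith [Real.exp_pos R]

/-- Up to a rotation of the source, automorphisms whose values at `0` are exponentially close
are close on a large disc. -/
theorem exists_rotation_forall_norm_le {σ τ : 𝔻 ≃ₜ 𝔻} (hσ : σ ∈ discAut) (hτ : τ ∈ discAut) :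
    ∃ θ : ℝ, ∀ R : ℝ, ∀ ξ ∈ closedHypDisc R, ∃ a : 𝔻,
      ‖(a : ℂ)‖ ≤ 2 * ‖(mob (-(σ 0)) (τ 0) : ℂ)‖ * Real.exp R ∧
      hypDist (σ ξ) (τ (Circle.exp θ • ξ)) = poincareDistZero a := by
  set g := σ⁻¹ * τ with hgdef
  have hg : g ∈ discAut := mul_mem (inv_mem hσ) hτ
  have hgσ : ∀ ξ, σ (g ξ) = τ ξ := fun ξ => σ.apply_symm_apply _
  set b := g 0 with hb
  have hmem : mobHomeo (-b) * g ∈ discAut := mul_mem (mobHomeo_mem _) hg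
  -- Undoing the translation by `b` leaves a rotation `c`, so rotating the source by `c⁻¹` turns `g`
  -- into `mob b`.
  obtain ⟨c, hc⟩ := exists_rotation_of_apply_zero hmem (mob_neg_self b)
  have hgc : ∀ ξ, g (c⁻¹ • ξ) = mob b ξ := fun ξ => by
    have h1 : mob (-b) (g (c⁻¹ • ξ)) = ξ := by
      have := hc (c⁻¹ • ξ)
      rwa [smul_inv_smul] at this
    have h2 := mob_neg_mob (-b) (g (c⁻¹ • ξ))
    rw [neg_neg, h1] at h2
    exact h2.symm
  have hbn : ‖(b : ℂ)‖ = ‖(mob (-(σ 0)) (τ 0) : ℂ)‖ := by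
    have h2 : mobHomeo (-(σ 0)) * σ ∈ discAut := mul_mem (mobHomeo_mem _) hσ
    have h3 := norm_apply_of_apply_zero h2 (mob_neg_self (σ 0)) b
    rw [← h3, ← hgσ 0]
    rfl
  obtain ⟨θ, hθ⟩ := Circle.exp_surjective c⁻¹
  refine ⟨θ, fun R ξ hξ => ⟨mob (-ξ) (mob b ξ), ?_, ?_⟩⟩
  · rw [← hbn]; exact norm_mob_neg_mob_le b ξ hξ
  · rw [hθ, ← hgσ, hypDist_map hσ, hgc, hypDist]

/-- The minimum of `f` on the compact set `C \ U` is positive. -/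
theorem exists_pos_forall_lt_mem {Y : Type*} [TopologicalSpace Y] {C U : Set Y} (hC : IsCompact C)
    (hU : IsOpen U) {f : Y → ℝ} (hf : Continuous f) (h : ∀ y ∈ C, f y ≤ 0 → y ∈ U) :
    ∃ η > 0, ∀ y ∈ C, f y < η → y ∈ U := by
  rcases (C \ U).eq_empty_or_nonempty with he | hne
  · exact ⟨1, one_pos, fun y hy _ => by
      by_contra hyU
      exact (he ▸ (⟨hy, hyU⟩ : y ∈ C \ U) : y ∈ (∅ : Set Y))⟩
  · obtain ⟨y₀, hy₀, hmin⟩ := (hC.diff hU).exists_isMinOn hne hf.continuousOn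
    refine ⟨f y₀, ?_, fun y hy hlt => ?_⟩
    · by_contra! hc
      exact hy₀.2 (h y₀ hy₀.1 hc)
    · by_contra hyU
      exact absurd (hmin (⟨hy, hyU⟩ : y ∈ C \ U)) (not_le.2 hlt)

theorem eventually_const_mul_exp_le (C : ℝ) {x b : ℝ} (h : x < b) :
    ∀ᶠ R : ℝ in atTop, C * Real.exp (x * R) ≤ Real.exp (b * R) := by
  have ht : Tendsto (fun R : ℝ => Real.exp ((b - x) * R)) atTop atTop :=
    Real.tendsto_exp_atTop.comp (tendsto_id.const_mul_atTop (sub_pos.2 h))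
  filter_upwards [ht.eventually_ge_atTop C] with R hR
  calc C * Real.exp (x * R) ≤ Real.exp ((b - x) * R) * Real.exp (x * R) := by gcongr
    _ = Real.exp (b * R) := by rw [← Real.exp_add]; ring_nf

/-! ### Surface groups -/

section SurfaceGroup

variable {Γ : Subgroup (𝔻 ≃ₜ 𝔻)}

theorem IsSurfaceGroup.mem_discAut (hΓ : IsSurfaceGroup Γ) (γ : Γ) : (γ : 𝔻 ≃ₜ 𝔻) ∈ discAut :=
  hΓ.le_discAut γ.2

theorem isOpenMap_surfaceMk : IsOpenMap (Surface.mk Γ) := by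
  intro U hU
  have h : Surface.mk Γ ⁻¹' (Surface.mk Γ '' U) = ⋃ γ : Γ, (γ : 𝔻 ≃ₜ 𝔻) '' U := by
    ext z
    simp only [mem_preimage, mem_image, mem_iUnion]
    constructor
    · rintro ⟨w, hw, hwz⟩
      obtain ⟨γ, hγ⟩ := Quotient.exact hwz
      exact ⟨γ, w, hw, hγ.symm⟩
    · rintro ⟨γ, w, hw, hwz⟩
      exact ⟨w, hw, Quotient.sound ⟨γ, hwz.symm⟩⟩
  refine isOpen_coinduced.2 ?_
  change IsOpen (Surface.mk Γ ⁻¹' _)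
  rw [h]
  exact isOpen_iUnion fun γ => (γ : 𝔻 ≃ₜ 𝔻).isOpenMap U hU

/-- A disc about `0` meets every orbit of a surface group. -/
theorem IsSurfaceGroup.exists_closedHypDisc (hΓ : IsSurfaceGroup Γ) :
    ∃ r : ℝ, 0 ≤ r ∧ ∀ z, ∃ γ : Γ, (γ : 𝔻 ≃ₜ 𝔻) z ∈ closedHypDisc r := by
  have := hΓ.compact
  obtain ⟨n, hn⟩ := isCompact_univ.elim_directed_cover
    (fun n : ℕ => Surface.mk Γ '' {z | poincareDistZero z < n})
    (fun n => isOpenMap_surfaceMk _ (isOpen_lt continuous_poincareDistZero continuous_const))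
    (fun x _ => by
      obtain ⟨z, rfl⟩ := Quotient.exists_rep x
      obtain ⟨n, hn⟩ := exists_nat_gt (poincareDistZero z)
      exact mem_iUnion.2 ⟨n, z, hn, rfl⟩)
    (directed_of_isDirected_le fun m n hmn => image_mono (by
      intro z hz
      exact lt_of_lt_of_le (show poincareDistZero z < m from hz) (Nat.cast_le.2 hmn)))
  refine ⟨n, n.cast_nonneg, fun z => ?_⟩
  obtain ⟨w, hw, hwz⟩ := hn (mem_univ (Surface.mk Γ z))
  obtain ⟨γ, rfl⟩ := Quotient.exact hwz
  refine ⟨γ⁻¹, ?_⟩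
  change (γ : 𝔻 ≃ₜ 𝔻).symm ((γ : 𝔻 ≃ₜ 𝔻) w) ∈ _
  rw [Homeomorph.symm_apply_apply]
  exact le_of_lt (show poincareDistZero w < n from hw)

/-- The injectivity radius of a compact surface is positive. -/
theorem IsSurfaceGroup.exists_le_hypDist (hΓ : IsSurfaceGroup Γ) :
    ∃ r > 0, ∀ γ : Γ, γ ≠ 1 → ∀ z, r ≤ hypDist z ((γ : 𝔻 ≃ₜ 𝔻) z) := by
  obtain ⟨r₀, -, hcov⟩ := hΓ.exists_closedHypDisc
  -- An element moving some point of the disc of radius `r₀` by at most `1` lies in this finite set.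
  have hA := hΓ.properlyDiscontinuous _ (isCompact_closedHypDisc (r₀ + 1))
  have hpos : ∀ g : 𝔻 ≃ₜ 𝔻, ∃ η > 0, g ∈ Γ → g ≠ 1 →
      ∀ z ∈ closedHypDisc r₀, η ≤ hypDist z (g z) := by
    intro g
    by_cases hg : g ∈ Γ ∧ g ≠ 1
    · have hcont : Continuous fun z => hypDist z (g z) :=
        continuous_hypDist_apply continuous_id g.continuous
      have hne : ∀ z ∈ closedHypDisc r₀, hypDist z (g z) ≤ 0 → z ∈ (∅ : Set 𝔻) := fun z _ hz =>
        (hΓ.free g hg.1 hg.2 z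
          (eq_of_hypDist_eq_zero (le_antisymm hz (hypDist_nonneg _ _))).symm).elim
      obtain ⟨η, hη, h⟩ :=
        exists_pos_forall_lt_mem (isCompact_closedHypDisc r₀) isOpen_empty hcont hne
      exact ⟨η, hη, fun _ _ z hz => not_lt.1 fun hlt => (h z hz hlt).elim⟩
    · exact ⟨1, one_pos, fun h1 h2 => absurd ⟨h1, h2⟩ hg⟩
  choose η hη0 hη using hpos
  have hev : ∀ᶠ m in 𝓝[>] (0 : ℝ), ∀ g ∈ {γ : 𝔻 ≃ₜ 𝔻 | γ ∈ Γ ∧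
      (γ '' closedHypDisc (r₀ + 1) ∩ closedHypDisc (r₀ + 1)).Nonempty}, m ≤ η g :=
    (eventually_all_finite hA).2 fun g _ =>
      eventually_nhdsWithin_of_eventually_nhds (eventually_le_nhds (hη0 g))
  obtain ⟨m, hm, hm0⟩ := (hev.and self_mem_nhdsWithin).exists
  have key : ∀ γ : Γ, γ ≠ 1 → ∀ z ∈ closedHypDisc r₀, min m 1 ≤ hypDist z ((γ : 𝔻 ≃ₜ 𝔻) z) := by
    intro γ hγ z hz
    by_cases h1 : hypDist z ((γ : 𝔻 ≃ₜ 𝔻) z) ≤ 1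
    · refine (min_le_left _ _).trans ((hm γ ⟨γ.2, (γ : 𝔻 ≃ₜ 𝔻) z, ⟨z, ?_, rfl⟩, ?_⟩).trans
        (hη γ γ.2 (fun h => hγ (Subtype.ext h)) z hz))
      · exact le_trans (mem_closedHypDisc.1 hz) (by linarith)
      · exact (poincareDistZero_le_add_hypDist z _).trans (add_le_add hz h1)
    · exact (min_le_right _ _).trans (not_le.1 h1).le
  refine ⟨min m 1, lt_min hm0 one_pos, fun γ hγ z => ?_⟩
  obtain ⟨α, hα⟩ := hcov z
  have h := key (α * γ * α⁻¹) (fun h => hγ (by simpa using h)) _ hα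
  rwa [show ((α * γ * α⁻¹ : Γ) : 𝔻 ≃ₜ 𝔻) ((α : 𝔻 ≃ₜ 𝔻) z) = (α : 𝔻 ≃ₜ 𝔻) ((γ : 𝔻 ≃ₜ 𝔻) z) from
    congrArg (fun w => (α : 𝔻 ≃ₜ 𝔻) ((γ : 𝔻 ≃ₜ 𝔻) w)) ((α : 𝔻 ≃ₜ 𝔻).symm_apply_apply z),
    hypDist_map (hΓ.mem_discAut α)] at h

theorem poincareDistZero_inv_apply_zero (hΓ : Γ ≤ discAut) (γ : Γ) :
    poincareDistZero (((γ⁻¹ : Γ) : 𝔻 ≃ₜ 𝔻) 0) = poincareDistZero ((γ : 𝔻 ≃ₜ 𝔻) 0) := by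
  rw [← hypDist_zero_right ((γ : 𝔻 ≃ₜ 𝔻) 0)]
  exact poincareDistZero_symm_apply (hΓ γ.2) 0

/-- An equivariant homeomorphism of the disc distorts the displacement of `0` at most
linearly. -/
theorem exists_poincareDistZero_le {Γ' : Subgroup (𝔻 ≃ₜ 𝔻)} (hΓ : IsSurfaceGroup Γ)
    (hΓ' : Γ' ≤ discAut) (φ : Γ → Γ') (F : 𝔻 ≃ₜ 𝔻)
    (hF : ∀ (γ : Γ) (z : 𝔻), F ((γ : 𝔻 ≃ₜ 𝔻) z) = (φ γ : 𝔻 ≃ₜ 𝔻) (F z)) :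
    ∃ L > 0, ∃ C : ℝ, ∀ γ : Γ, poincareDistZero ((φ γ : 𝔻 ≃ₜ 𝔻) 0) ≤
      L * poincareDistZero ((γ : 𝔻 ≃ₜ 𝔻) 0) + C := by
  obtain ⟨r₀, -, hcov⟩ := hΓ.exists_closedHypDisc
  have hcont : Continuous fun p : 𝔻 × 𝔻 => hypDist (F p.1) (F p.2) :=
    continuous_hypDist_apply (F.continuous.comp continuous_fst) (F.continuous.comp continuous_snd)
  obtain ⟨L, hL⟩ := ((isCompact_closedHypDisc r₀).prod
    (isCompact_closedHypDisc (r₀ + 1))).bddAbove_image hcont.continuousOn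
  -- Equivariance moves the pair into a fixed compact set, where the continuous function `hypDist (F
  -- z) (F w)` is bounded; unit steps along a radius then give a linear bound.
  have hstep : ∀ z w, hypDist z w ≤ 1 → hypDist (F z) (F w) ≤ max L 1 := by
    intro z w hzw
    obtain ⟨α, hα⟩ := hcov z
    rw [← hypDist_map (hΓ' (φ α).2), ← hF, ← hF]
    have hmem : ((α : 𝔻 ≃ₜ 𝔻) w) ∈ closedHypDisc (r₀ + 1) := by
      refine (poincareDistZero_le_add_hypDist ((α : 𝔻 ≃ₜ 𝔻) z) _).trans (add_le_add hα ?_)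
      rwa [hypDist_map (hΓ.mem_discAut α)]
    exact (hL (mem_image_of_mem _ (mk_mem_prod hα hmem))).trans (le_max_left _ _)
  have hchain : ∀ n : ℕ, ∀ z, poincareDistZero z ≤ n → hypDist (F 0) (F z) ≤ n * max L 1 := by
    intro n
    induction n with
    | zero =>
      intro z hz
      rw [poincareDistZero_eq_zero (le_antisymm (by simpa using hz) (poincareDistZero_nonneg z)),
        hypDist_self]
      simp
    | succ n ih =>
      intro z hz
      obtain ⟨w, hw, hwz⟩ := exists_hypDist_le n.cast_nonneg zero_le_one (by simpa using hz)
      have h1 := hypDist_triangle (F 0) (F w) (F z)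
      push_cast
      linarith [ih w hw, hstep w z hwz]
  refine ⟨max L 1, by positivity, max L 1 + 2 * poincareDistZero (F 0), fun γ => ?_⟩
  set z := (γ : 𝔻 ≃ₜ 𝔻) 0
  have h1 := hchain ⌈poincareDistZero z⌉₊ z (Nat.le_ceil _)
  have h2 := (Nat.ceil_lt_add_one (poincareDistZero_nonneg z)).le
  have h3 : (⌈poincareDistZero z⌉₊ : ℝ) * max L 1 ≤ (poincareDistZero z + 1) * max L 1 :=
    mul_le_mul_of_nonneg_right h2 (by positivity)
  have h4 := poincareDistZero_le_add_hypDist (F 0) (F z)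
  have h5 := poincareDistZero_le_add_hypDist (F z) ((φ γ : 𝔻 ≃ₜ 𝔻) 0)
  rw [hF γ 0, hypDist_map (hΓ' (φ γ).2), hypDist_zero_right, ← hF γ 0] at h5
  linarith

end SurfaceGroup

/-! ### The transverse growth of a representation -/

section Transverse

variable {Γ : Subgroup (𝔻 ≃ₜ 𝔻)} {T : Type*} [MetricSpace T]

/-- Some element of `Γ` displacing `0` by at most `R` moves `s` and `t` at distance at least `δ`
apart. -/
def TransSep (ρ : Γ →* (T ≃ₜ T)) (R δ : ℝ) (s t : T) : Prop :=
  ∃ γ : Γ, poincareDistZero ((γ : 𝔻 ≃ₜ 𝔻) 0) ≤ R ∧ δ ≤ dist (ρ γ s) (ρ γ t)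

theorem TransSep.symm {ρ : Γ →* (T ≃ₜ T)} {R δ : ℝ} {s t : T} (h : TransSep ρ R δ s t) :
    TransSep ρ R δ t s := by
  obtain ⟨γ, h1, h2⟩ := h
  exact ⟨γ, h1, by rwa [dist_comm]⟩

/-- The exponential growth rate, with `R`, of the number of points of `T` that are separated by
elements of `Γ` displacing `0` by at most `R` is at most `a`. -/
def TransGrowth (ρ : Γ →* (T ≃ₜ T)) (a : ℝ) : Prop :=
  ∀ δ > 0, ∀ b > a, ∀ᶠ R : ℝ in atTop, ∀ S : Finset T,
    (S : Set T).Pairwise (TransSep ρ R δ) → (S.card : ℝ) ≤ Real.exp (b * R)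

theorem TransGrowth.of_isEmpty [IsEmpty T] (ρ : Γ →* (T ≃ₜ T)) (a : ℝ) : TransGrowth ρ a :=
  fun δ _ b _ => Eventually.of_forall fun R S _ => by
    rw [Finset.eq_empty_of_isEmpty S]
    simpa using (Real.exp_pos _).le

/-- A singleton is vacuously separated, so the count is at least `1`. This becomes the lower bound 2
for the entropy. -/
theorem TransGrowth.nonneg [Nonempty T] {ρ : Γ →* (T ≃ₜ T)} {a : ℝ} (h : TransGrowth ρ a) :
    0 ≤ a := by
  by_contra! ha
  obtain ⟨t⟩ := ‹Nonempty T›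
  obtain ⟨R, hR, hR0⟩ := ((h 1 one_pos (a / 2) (by linarith)).and (eventually_gt_atTop 0)).exists
  have h1 := hR {t} (by simp)
  have h2 : Real.exp (a / 2 * R) < 1 := Real.exp_lt_one_iff.2 (by nlinarith)
  simp at h1
  nlinarith

/-- A separated set of maximal cardinality is spanning; this turns a bound on separated sets into a
covering. -/
theorem exists_maximal_pairwise {α : Type*} {r : α → α → Prop} (hr : ∀ x y, r x y → r y x) {B : ℝ}
    (hB : ∀ S : Finset α, (S : Set α).Pairwise r → (S.card : ℝ) ≤ B) :
    ∃ S : Finset α, (S : Set α).Pairwise r ∧ ∀ x, ∃ y ∈ S, y = x ∨ ¬ r y x := by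
  classical
  set P : ℕ → Prop := fun n => ∃ S : Finset α, (S : Set α).Pairwise r ∧ S.card = n
  have hP0 : P 0 := ⟨∅, by simp, rfl⟩
  obtain ⟨S, hS, hcard⟩ : P (Nat.findGreatest P ⌊B⌋₊) :=
    Nat.findGreatest_spec (Nat.zero_le _) hP0
  refine ⟨S, hS, fun x => ?_⟩
  by_contra! hx
  have hxS : x ∉ S := fun h => (hx x h).1 rfl
  have hins : P (S.card + 1) := by
    refine ⟨insert x S, ?_, Finset.card_insert_of_notMem hxS⟩
    rw [Finset.coe_insert]
    exact hS.insert fun y hy _ => ⟨hr _ _ (hx y hy).2, (hx y hy).2⟩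
  obtain ⟨S', hS', hcard'⟩ := id hins
  have h1 : S.card + 1 ≤ ⌊B⌋₊ := Nat.le_floor (by rw [← hcard']; exact hB S' hS')
  have h2 := Nat.le_findGreatest h1 hins
  omega

/-- Transverse growth rates are comparable for representations conjugate under an isomorphism
induced by a homeomorphism of surfaces. -/
theorem exists_transGrowth_of_conj {Γ₁ Γ₂ : Subgroup (𝔻 ≃ₜ 𝔻)} (hΓ₁ : Γ₁ ≤ discAut)
    (hΓ₂ : IsSurfaceGroup Γ₂) {T₁ T₂ : Type*} [MetricSpace T₁] [CompactSpace T₁] [MetricSpace T₂]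
    (φ : Γ₁ ≃* Γ₂) (F : 𝔻 ≃ₜ 𝔻)
    (hF : ∀ (γ : Γ₁) (z : 𝔻), F ((γ : 𝔻 ≃ₜ 𝔻) z) = (φ γ : 𝔻 ≃ₜ 𝔻) (F z)) (Ψ : T₁ ≃ₜ T₂)
    (ρ₁ : Γ₁ →* (T₁ ≃ₜ T₁)) (ρ₂ : Γ₂ →* (T₂ ≃ₜ T₂))
    (hρ : ∀ (γ : Γ₂) (t : T₂), ρ₂ γ t = Ψ (ρ₁ (φ.symm γ) (Ψ.symm t))) :
    ∃ L : ℝ, ∀ a, TransGrowth ρ₁ a → TransGrowth ρ₂ (L * a) := by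
  obtain ⟨L, hL, C, hLC⟩ := exists_poincareDistZero_le hΓ₂ hΓ₁ φ.symm F.symm fun γ z => by
    rw [F.symm_apply_eq, hF]
    simp
  refine ⟨L, fun a ha δ hδ b hb => ?_⟩
  obtain ⟨δ', hδ', hunif⟩ := Metric.uniformContinuous_iff.1
    (CompactSpace.uniformContinuous_of_continuous Ψ.continuous) δ hδ
  -- The gap between `b' * L` and `b` absorbs the factor `exp (b' * C)` caused by the additive
  -- constant.
  obtain ⟨b', hab', hb'⟩ := exists_between (show a < b / L by rwa [lt_div_iff₀ hL, mul_comm])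
  have ht : Tendsto (fun R : ℝ => L * R + C) atTop atTop :=
    tendsto_atTop_add_const_right _ _ (tendsto_id.const_mul_atTop hL)
  filter_upwards [ht.eventually (ha δ' hδ' b' hab'), eventually_const_mul_exp_le
    (Real.exp (b' * C)) (show b' * L < b by rwa [← lt_div_iff₀ hL])] with R hR hR' S hS
  have h1 := hR (S.map Ψ.symm.toEquiv.toEmbedding) ?_
  · rw [Finset.card_map] at h1
    refine h1.trans (le_trans (le_of_eq ?_) hR')
    rw [← Real.exp_add]
    ring_nf
  · intro x hx y hy hxy
    rw [Finset.coe_map] at hx hy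
    obtain ⟨s, hs, rfl⟩ := hx
    obtain ⟨t, ht, rfl⟩ := hy
    obtain ⟨γ, hγ, hd⟩ := hS hs ht fun h => hxy (by rw [h])
    refine ⟨φ.symm γ, (hLC γ).trans (by gcongr), ?_⟩
    rw [hρ, hρ] at hd
    exact not_lt.1 fun hlt => absurd (hunif hlt) (not_lt.2 hd)

end Transverse

/-! ### Distances in suspensions -/

section Suspension

variable {Γ : Subgroup (𝔻 ≃ₜ 𝔻)} {T : Type*} [MetricSpace T] (ρ : Γ →* (T ≃ₜ T))

theorem Suspension.mk_eq_mk {ρ : Γ →* (T ≃ₜ T)} {z w : 𝔻} {s t : T} :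
    Suspension.mk ρ z s = Suspension.mk ρ w t ↔ ∃ γ : Γ, w = (γ : 𝔻 ≃ₜ 𝔻) z ∧ t = ρ γ s := by
  refine Quotient.eq.trans (exists_congr fun γ => ?_)
  exact Prod.ext_iff

theorem Suspension.mk_smul (γ : Γ) (z : 𝔻) (t : T) :
    Suspension.mk ρ ((γ : 𝔻 ≃ₜ 𝔻) z) (ρ γ t) = Suspension.mk ρ z t :=
  (Suspension.mk_eq_mk.2 ⟨γ, rfl, rfl⟩).symm

theorem Suspension.continuous_mk : Continuous fun p : 𝔻 × T => Suspension.mk ρ p.1 p.2 :=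
  continuous_quotient_mk'

variable {ρ}

/-- A deck transformation moves the given lift to the prescribed representative `(z, t)` of the base
point. -/
theorem IsLeafUniformization.exists_eq (hΓ : Γ ≤ discAut) {z : 𝔻} {t : T} {f : 𝔻 → Suspension ρ}
    (hf : IsLeafUniformization ρ (Suspension.mk ρ z t) f) :
    ∃ τ ∈ discAut, τ 0 = z ∧ ∀ ξ, f ξ = Suspension.mk ρ (τ ξ) t := by
  obtain ⟨h0, s, τ, hτ, h⟩ := hf
  rw [h 0, Suspension.mk_eq_mk] at h0
  obtain ⟨γ, hz, hs⟩ := h0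
  refine ⟨γ * τ, mul_mem (hΓ γ.2) hτ, hz.symm, fun ξ => ?_⟩
  rw [h, hs]
  exact (Suspension.mk_smul ρ γ (τ ξ) s).symm

variable [CompactSpace T] {M : Type*} [MetricSpace M] {ι : Suspension ρ → M}

/-- Uniform continuity of the projection modulo `Γ`. Since `ρ` need not be isometric, transverse
distance is measured after an `α` bringing `z` into a fixed compact disc. -/
theorem exists_dist_lt_of_hypDist_lt (hΓ : Γ ≤ discAut) (hι : Continuous ι) (r : ℝ) {ε : ℝ}
    (hε : 0 < ε) :
    ∃ η > 0, ∀ (z w : 𝔻) (s t : T) (α : Γ), (α : 𝔻 ≃ₜ 𝔻) z ∈ closedHypDisc r →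
      hypDist z w < η → dist (ρ α s) (ρ α t) < η →
      dist (ι (Suspension.mk ρ z s)) (ι (Suspension.mk ρ w t)) < ε := by
  have hq := hι.comp (Suspension.continuous_mk ρ)
  obtain ⟨η, hη, h⟩ := exists_pos_forall_lt_mem
    (C := (closedHypDisc r ×ˢ univ) ×ˢ (closedHypDisc (r + 1) ×ˢ univ))
    (U := {p : (𝔻 × T) × (𝔻 × T) |
      dist (ι (Suspension.mk ρ p.1.1 p.1.2)) (ι (Suspension.mk ρ p.2.1 p.2.2)) < ε})
    (f := fun p => max (hypDist p.1.1 p.2.1) (dist p.1.2 p.2.2))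
    (((isCompact_closedHypDisc r).prod isCompact_univ).prod
      ((isCompact_closedHypDisc (r + 1)).prod isCompact_univ))
    (isOpen_lt ((hq.comp continuous_fst).dist (hq.comp continuous_snd)) continuous_const)
    ((continuous_hypDist_apply (continuous_fst.comp continuous_fst) (continuous_fst.comp continuous_snd)).max
      ((continuous_snd.comp continuous_fst).dist (continuous_snd.comp continuous_snd)))
    (by
      rintro ⟨⟨z, s⟩, ⟨w, t⟩⟩ - h
      have h1 : z = w := eq_of_hypDist_eq_zero
        (le_antisymm ((le_max_left _ _).trans h) (hypDist_nonneg _ _))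
      have h2 : s = t := dist_le_zero.1 ((le_max_right _ _).trans h)
      subst h1 h2
      change dist _ _ < ε
      rwa [dist_self])
  refine ⟨min η 1, lt_min hη one_pos, fun z w s t α hα hzw hst => ?_⟩
  rw [← hypDist_map (hΓ α.2)] at hzw
  have := h (((α : 𝔻 ≃ₜ 𝔻) z, ρ α s), ((α : 𝔻 ≃ₜ 𝔻) w, ρ α t)) ⟨⟨hα, mem_univ _⟩, ?_, mem_univ _⟩
    (max_lt (hzw.trans_le (min_le_left _ _)) (hst.trans_le (min_le_left _ _)))
  · change dist _ _ < ε at this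
    rwa [Suspension.mk_smul, Suspension.mk_smul] at this
  · exact (poincareDistZero_le_add_hypDist ((α : 𝔻 ≃ₜ 𝔻) z) _).trans
      (add_le_add hα (hzw.le.trans (min_le_right _ _)))

/-- The converse comparison: `ι` is injective and a compact disc meets every orbit. The two points
are brought there by unrelated elements, hence the extra `γ`. -/
theorem exists_hypDist_lt_of_dist_lt (hΓ : IsSurfaceGroup Γ) (hι : IsEmbedding ι) {r : ℝ}
    (hr : ∀ z, ∃ γ : Γ, (γ : 𝔻 ≃ₜ 𝔻) z ∈ closedHypDisc r) {η : ℝ} (hη : 0 < η) :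
    ∃ ε > 0, ∀ (z w : 𝔻) (s t : T) (α : Γ), (α : 𝔻 ≃ₜ 𝔻) z ∈ closedHypDisc r →
      dist (ι (Suspension.mk ρ z s)) (ι (Suspension.mk ρ w t)) < ε →
      ∃ γ : Γ, hypDist z ((γ : 𝔻 ≃ₜ 𝔻) w) < η ∧ dist (ρ α s) (ρ α (ρ γ t)) < η := by
  have hq := hι.continuous.comp (Suspension.continuous_mk ρ)
  obtain ⟨ε, hε, h⟩ := exists_pos_forall_lt_mem
    (C := (closedHypDisc r ×ˢ univ) ×ˢ (closedHypDisc r ×ˢ univ))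
    (U := {p : (𝔻 × T) × (𝔻 × T) | ∃ γ : Γ,
      hypDist p.1.1 ((γ : 𝔻 ≃ₜ 𝔻) p.2.1) < η ∧ dist p.1.2 (ρ γ p.2.2) < η})
    (f := fun p =>
      dist (ι (Suspension.mk ρ p.1.1 p.1.2)) (ι (Suspension.mk ρ p.2.1 p.2.2)))
    (((isCompact_closedHypDisc r).prod isCompact_univ).prod
      ((isCompact_closedHypDisc r).prod isCompact_univ))
    (by
      rw [ofPred_exists]
      refine isOpen_iUnion fun γ => IsOpen.inter
        (isOpen_lt (continuous_hypDist_apply (continuous_fst.comp continuous_fst)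
          ((γ : 𝔻 ≃ₜ 𝔻).continuous.comp (continuous_fst.comp continuous_snd))) continuous_const)
        (isOpen_lt ((continuous_snd.comp continuous_fst).dist
          ((ρ γ).continuous.comp (continuous_snd.comp continuous_snd))) continuous_const))
    ((hq.comp continuous_fst).dist (hq.comp continuous_snd))
    (by
      rintro ⟨⟨z, s⟩, ⟨w, t⟩⟩ - h
      obtain ⟨γ, hz, hs⟩ := Suspension.mk_eq_mk.1 (hι.injective (dist_le_zero.1 h)).symm
      exact ⟨γ, by rw [← hz, hypDist_self]; exact hη, by rw [← hs, dist_self]; exact hη⟩)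
  refine ⟨ε, hε, fun z w s t α hα hd => ?_⟩
  obtain ⟨β, hβ⟩ := hr w
  obtain ⟨γ, h1, h2⟩ := h (((α : 𝔻 ≃ₜ 𝔻) z, ρ α s), ((β : 𝔻 ≃ₜ 𝔻) w, ρ β t))
    ⟨⟨hα, mem_univ _⟩, hβ, mem_univ _⟩ (by simpa only [Suspension.mk_smul] using hd)
  have e : α * (α⁻¹ * γ * β) = γ * β := by group
  refine ⟨α⁻¹ * γ * β, ?_, ?_⟩
  · rw [← hypDist_map (hΓ.mem_discAut α)]
    change hypDist _ (((α * (α⁻¹ * γ * β) : Γ) : 𝔻 ≃ₜ 𝔻) w) < η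
    rwa [e]
  · change dist _ ((ρ α * ρ (α⁻¹ * γ * β)) t) < η
    rw [← map_mul, e, map_mul]
    exact h2

end Suspension

/-! ### Grids in the disc -/

/-- One representative in `K` for each occupied square of side `s`. There are `2 * ⌈1 / s⌉ + 1 ≤ 5 /
s` indices per axis. -/
theorem exists_finset_forall_norm_sub_le (K : Set 𝔻) {s : ℝ} (hs : 0 < s) (hs1 : s ≤ 1) :
    ∃ Z : Finset 𝔻, (Z.card : ℝ) ≤ (5 / s) ^ 2 ∧
      ∀ w ∈ K, ∃ z ∈ Z, z ∈ K ∧ ‖(w : ℂ) - z‖ ≤ 2 * s := by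
  classical
  set cell : 𝔻 → ℤ × ℤ := fun w => (⌊(w : ℂ).re / s⌋, ⌊(w : ℂ).im / s⌋) with hcell
  have hrep : ∀ p : ℤ × ℤ, ∃ z : 𝔻, (∃ w ∈ K, cell w = p) → z ∈ K ∧ cell z = p := fun p => by
    by_cases h : ∃ w ∈ K, cell w = p
    · obtain ⟨w, hw⟩ := h
      exact ⟨w, fun _ => hw⟩
    · exact ⟨0, fun h' => absurd h' h⟩
  choose rep hrep using hrep
  set N : ℕ := ⌈1 / s⌉₊
  have hN : 1 / s ≤ N := Nat.le_ceil _
  have hfloor : ∀ x : ℝ, |x| ≤ 1 → ⌊x / s⌋ ∈ Finset.Icc (-(N : ℤ)) N := fun x hx => by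
    have h1 : |x / s| ≤ N := by
      rw [abs_div, abs_of_pos hs]
      exact (div_le_div_of_nonneg_right hx hs.le).trans hN
    rw [Finset.mem_Icc, Int.le_floor]
    refine ⟨by push_cast; exact (abs_le.1 h1).1, ?_⟩
    have h2 := (Int.floor_le (x / s)).trans (abs_le.1 h1).2
    exact_mod_cast h2
  have hclose : ∀ x y : ℝ, ⌊x / s⌋ = ⌊y / s⌋ → |x - y| ≤ s := fun x y h => by
    have h1 := (Int.abs_sub_lt_one_of_floor_eq_floor h).le
    rwa [← sub_div, abs_div, abs_of_pos hs, div_le_one hs] at h1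
  refine ⟨(Finset.Icc (-(N : ℤ)) N ×ˢ Finset.Icc (-(N : ℤ)) N).image rep, ?_, fun w hw => ?_⟩
  · have h1 : ((Finset.Icc (-(N : ℤ)) N ×ˢ Finset.Icc (-(N : ℤ)) N).image rep).card ≤
        (2 * N + 1) ^ 2 := by
      refine Finset.card_image_le.trans (le_of_eq ?_)
      rw [Finset.card_product, Int.card_Icc, sq]
      congr 1 <;> omega
    have h2 : (2 * N + 1 : ℝ) ≤ 5 / s := by
      have h3 := (Nat.ceil_lt_add_one (show 0 ≤ 1 / s by positivity)).le
      have h4 : 1 ≤ 1 / s := by rwa [le_div_iff₀ hs, one_mul]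
      have h5 : 5 / s = 5 * (1 / s) := by ring
      change (N : ℝ) ≤ _ at h3
      linarith
    calc _ ≤ ((2 * N + 1 : ℕ) : ℝ) ^ 2 := by exact_mod_cast h1
      _ ≤ (5 / s) ^ 2 := by push_cast; gcongr
  · obtain ⟨hz, hzw⟩ := hrep (cell w) ⟨w, hw, rfl⟩
    refine ⟨rep (cell w), Finset.mem_image_of_mem _ (Finset.mem_product.2
      ⟨hfloor _ ((Complex.abs_re_le_norm _).trans w.norm_lt_one.le),
        hfloor _ ((Complex.abs_im_le_norm _).trans w.norm_lt_one.le)⟩), hz, ?_⟩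
    have h1 := hclose _ _ (congrArg Prod.fst hzw).symm
    have h2 := hclose _ _ (congrArg Prod.snd hzw).symm
    refine (Complex.norm_le_abs_re_add_abs_im _).trans ?_
    rw [Complex.sub_re, Complex.sub_im]
    linarith

/-- The grid `s * (i, j)` with `i, j < ⌊ρ / (2 * s)⌋`; the condition `4 * s ≤ ρ` makes the floor
lose at most half. -/
theorem exists_finset_separated {ρ s : ℝ} (hρ : ρ < 1) (hs : 0 < s) (hsρ : 4 * s ≤ ρ) :
    ∃ Z : Finset 𝔻, (∀ z ∈ Z, ‖(z : ℂ)‖ ≤ ρ) ∧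
      (∀ z ∈ Z, ∀ w ∈ Z, ‖(z : ℂ) - w‖ < s → z = w) ∧ (ρ / (4 * s)) ^ 2 ≤ Z.card := by
  classical
  have hρ0 : 0 < ρ := by linarith
  set n := ⌊ρ / (2 * s)⌋₊
  have hn : (n : ℝ) ≤ ρ / (2 * s) := Nat.floor_le (by positivity)
  rw [le_div_iff₀ (by positivity)] at hn
  have hnorm : ∀ p : Fin n × Fin n, ‖(⟨s * p.1, s * p.2⟩ : ℂ)‖ ≤ ρ := fun p => by
    refine (Complex.norm_le_abs_re_add_abs_im _).trans ?_
    have h1 : ((p.1 : ℕ) : ℝ) ≤ n := by exact_mod_cast p.1.2.le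
    have h2 : ((p.2 : ℕ) : ℝ) ≤ n := by exact_mod_cast p.2.2.le
    rw [abs_of_nonneg (by positivity), abs_of_nonneg (by positivity)]
    nlinarith
  have hcoord : ∀ i j : Fin n, |s * ((i : ℕ) : ℝ) - s * ((j : ℕ) : ℝ)| < s → i = j := by
    intro i j h
    rw [← mul_sub, abs_mul, abs_of_pos hs] at h
    have h1 : |((i : ℕ) : ℝ) - ((j : ℕ) : ℝ)| < 1 := by nlinarith
    have h2 : |((i : ℕ) : ℤ) - ((j : ℕ) : ℤ)| < 1 := by exact_mod_cast h1
    have h3 := Int.abs_lt_one_iff.1 h2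
    exact Fin.ext (by omega)
  set f : Fin n × Fin n → 𝔻 := fun p =>
    Complex.UnitDisc.mk ⟨s * p.1, s * p.2⟩ ((hnorm p).trans_lt hρ)
  have hsep : ∀ p q, ‖(f p : ℂ) - f q‖ < s → p = q := fun p q h =>
    Prod.ext (hcoord _ _ ((Complex.abs_re_le_norm _).trans_lt h))
      (hcoord _ _ ((Complex.abs_im_le_norm _).trans_lt h))
  have hinj : Function.Injective f := fun p q h => hsep p q (by rwa [h, sub_self, norm_zero])
  refine ⟨Finset.univ.image f, ?_, ?_, ?_⟩
  · intro z hz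
    obtain ⟨p, -, rfl⟩ := Finset.mem_image.1 hz
    exact hnorm p
  · intro z hz w hw h
    obtain ⟨p, -, rfl⟩ := Finset.mem_image.1 hz
    obtain ⟨q, -, rfl⟩ := Finset.mem_image.1 hw
    rw [hsep p q h]
  · rw [Finset.card_image_of_injective _ hinj, Finset.card_univ, Fintype.card_prod,
      Fintype.card_fin, Nat.cast_mul, ← sq]
    have h1 := Nat.lt_floor_add_one (ρ / (2 * s))
    have h2 : 1 ≤ ρ / (4 * s) := by rwa [le_div_iff₀ (by positivity), one_mul]
    have h3 : ρ / (2 * s) = 2 * (ρ / (4 * s)) := by field_simp; ring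
    refine pow_le_pow_left₀ (by linarith) ?_ 2
    change _ < (n : ℝ) + 1 at h1
    linarith

/-! ### Entropy and coverings -/

section Entropy

variable {X M : Type*} [MetricSpace M]

theorem mem_bowenBall_of_forall_dist_le {ι : X → M} {u : X → 𝔻 → X} {R ε ε' : ℝ} {x y : X}
    (hε : ε < ε') (hε' : 0 < ε') (θ : ℝ)
    (h : ∀ ξ ∈ closedHypDisc R, dist (ι (u x ξ)) (ι (u y (Circle.exp θ • ξ))) ≤ ε) :
    y ∈ bowenBall ι u R x ε' := by
  refine lt_of_le_of_lt ((iInf_le _ θ).trans (iSup₂_le (a := ENNReal.ofReal ε) fun ξ hξ => ?_))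
    ((ENNReal.ofReal_lt_ofReal_iff hε').2 hε)
  rw [edist_dist]
  exact ENNReal.ofReal_le_ofReal (h ξ hξ)

theorem exists_forall_dist_lt_of_mem_bowenBall {ι : X → M} {u : X → 𝔻 → X} {R ε : ℝ} {x y : X}
    (h : y ∈ bowenBall ι u R x ε) :
    ∃ θ : ℝ, ∀ ξ ∈ closedHypDisc R, dist (ι (u x ξ)) (ι (u y (Circle.exp θ • ξ))) < ε := by
  obtain ⟨θ, hθ⟩ := iInf_lt_iff.1 (show bowenDist ι u R x y < ENNReal.ofReal ε from h)
  refine ⟨θ, fun ξ hξ => edist_lt_ofReal.1 (lt_of_le_of_lt ?_ hθ)⟩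
  exact le_iSup₂ (f := fun ξ (_ : ξ ∈ closedHypDisc R) =>
    edist (ι (u x ξ)) (ι (u y (Circle.exp θ • ξ)))) ξ hξ

theorem coveringNumber_le_ofReal_iff {ι : X → M} {u : X → 𝔻 → X} {Y : Set X} {R ε B : ℝ}
    (hB : 0 ≤ B) :
    (coveringNumber ι u Y R ε : ℝ≥0∞) ≤ ENNReal.ofReal B ↔
      ∃ F : Finset X, Y ⊆ ⋃ x ∈ F, bowenBall ι u R x ε ∧ (F.card : ℝ) ≤ B := by
  constructor
  · intro h
    have hne : coveringNumber ι u Y R ε ≠ ⊤ := fun htop => by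
      rw [htop] at h
      exact absurd h (by simp)
    obtain ⟨n, hn⟩ := ENat.ne_top_iff_exists.1 hne
    have hlt : coveringNumber ι u Y R ε < ((n + 1 : ℕ) : ℕ∞) := by
      rw [← hn]
      exact_mod_cast n.lt_succ_self
    obtain ⟨F, hF⟩ := iInf_lt_iff.1 hlt
    obtain ⟨hcov, hF⟩ := iInf_lt_iff.1 hF
    have hcard : F.card ≤ n := Nat.lt_succ_iff.1 (by exact_mod_cast hF)
    refine ⟨F, hcov, le_trans (Nat.cast_le.2 hcard) ?_⟩
    rw [← hn, ENat.toENNReal_coe, ← ENNReal.ofReal_natCast, ENNReal.ofReal_le_ofReal_iff hB] at h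
    exact h
  · rintro ⟨F, hcov, hF⟩
    have h1 : coveringNumber ι u Y R ε ≤ (F.card : ℕ∞) := iInf₂_le F hcov
    calc (coveringNumber ι u Y R ε : ℝ≥0∞) ≤ ((F.card : ℕ∞) : ℝ≥0∞) := ENat.toENNReal_le.2 h1
      _ = ENNReal.ofReal F.card := by rw [ENat.toENNReal_coe, ENNReal.ofReal_natCast]
      _ ≤ ENNReal.ofReal B := ENNReal.ofReal_le_ofReal hF

theorem log_div_le_iff {a : ℝ≥0∞} {b R : ℝ} (hR : 0 < R) :
    ENNReal.log a / (R : EReal) ≤ b ↔ a ≤ ENNReal.ofReal (Real.exp (b * R)) := by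
  rw [EReal.div_le_iff_le_mul (EReal.coe_pos.2 hR) (EReal.coe_ne_top R), ← EReal.coe_mul,
    ← ENNReal.log_le_log_iff, ENNReal.log_ofReal_of_pos (Real.exp_pos _), Real.log_exp, mul_comm]

theorem hyperbolicEntropy_le_coe_iff {ι : X → M} {u : X → 𝔻 → X} {c : ℝ} :
    hyperbolicEntropy ι u ≤ (c : EReal) ↔ ∀ ε > 0, ∀ b > c, ∀ᶠ R : ℝ in atTop,
      ∃ F : Finset X, univ ⊆ ⋃ x ∈ F, bowenBall ι u R x ε ∧
        (F.card : ℝ) ≤ Real.exp (b * R) := by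
  rw [hyperbolicEntropy, entropyOn, iSup₂_le_iff]
  refine forall₂_congr fun ε _ => ?_
  rw [limsup_le_iff']
  constructor
  · intro h b hb
    filter_upwards [h b (EReal.coe_lt_coe_iff.2 hb), eventually_gt_atTop 0] with R hR hR0
    rwa [log_div_le_iff hR0, coveringNumber_le_ofReal_iff (Real.exp_pos _).le] at hR
  · intro h y hy
    obtain ⟨b, hb, hby⟩ := EReal.lt_iff_exists_real_btwn.1 hy
    filter_upwards [h b (EReal.coe_lt_coe_iff.1 hb), eventually_gt_atTop 0] with R hR hR0
    refine le_trans ?_ hby.le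
    rwa [log_div_le_iff hR0, coveringNumber_le_ofReal_iff (Real.exp_pos _).le]

end Entropy

/-! ### Entropy of suspensions and transverse growth -/

section Suspension

variable {Γ : Subgroup (𝔻 ≃ₜ 𝔻)} {T : Type*} [MetricSpace T]
  {ρ : Γ →* (T ≃ₜ T)} {M : Type*} [MetricSpace M] {ι : Suspension ρ → M}
  {u : Suspension ρ → 𝔻 → Suspension ρ}

/-- Leaves that are uniformly close on a disc stay close after lifting to `𝔻 × T`. -/
theorem forall_hypDist_lt_of_forall_dist_lt {r η ε R : ℝ} (hR : 0 ≤ R)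
    (hcov : ∀ z, ∃ γ : Γ, (γ : 𝔻 ≃ₜ 𝔻) z ∈ closedHypDisc r)
    (hinj : ∀ γ : Γ, γ ≠ 1 → ∀ z, 3 * η ≤ hypDist z ((γ : 𝔻 ≃ₜ 𝔻) z))
    (hclose : ∀ (z w : 𝔻) (s t : T) (α : Γ), (α : 𝔻 ≃ₜ 𝔻) z ∈ closedHypDisc r →
      dist (ι (Suspension.mk ρ z s)) (ι (Suspension.mk ρ w t)) < ε →
      ∃ γ : Γ, hypDist z ((γ : 𝔻 ≃ₜ 𝔻) w) < η ∧ dist (ρ α s) (ρ α (ρ γ t)) < η)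
    {σ τ : 𝔻 ≃ₜ 𝔻} {s t : T} (h0 : hypDist (σ 0) (τ 0) < η)
    (h : ∀ ξ ∈ closedHypDisc R,
      dist (ι (Suspension.mk ρ (σ ξ) s)) (ι (Suspension.mk ρ (τ ξ) t)) < ε) :
    (∀ ξ ∈ closedHypDisc R, hypDist (σ ξ) (τ ξ) < η) ∧ ∀ ξ ∈ closedHypDisc R, ∀ α : Γ,
      (α : 𝔻 ≃ₜ 𝔻) (σ ξ) ∈ closedHypDisc r → dist (ρ α s) (ρ α t) < η := by
  have hη : 0 < η := (hypDist_nonneg _ _).trans_lt h0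
  -- A nontrivial `γ` would move `τ ξ` by less than `2 * η`, below the injectivity bound `3 * η`.
  have hone : ∀ (ξ : 𝔻) (γ : Γ), hypDist (σ ξ) (τ ξ) ≤ η →
      hypDist (σ ξ) ((γ : 𝔻 ≃ₜ 𝔻) (τ ξ)) < η → γ = 1 := by
    intro ξ γ h1 h2
    by_contra hγ
    have h3 := hypDist_triangle (τ ξ) (σ ξ) ((γ : 𝔻 ≃ₜ 𝔻) (τ ξ))
    rw [hypDist_comm (τ ξ) (σ ξ)] at h3
    linarith [hinj γ hγ (τ ξ)]
  -- At distance exactly `η` the element supplied by `hclose` would be `1`, giving distance less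
  -- than `η`. As the disc is connected, the distance never crosses `η`.
  have hne : ∀ ξ ∈ closedHypDisc R, hypDist (σ ξ) (τ ξ) ≠ η := by
    intro ξ hξ heq
    obtain ⟨α, hα⟩ := hcov (σ ξ)
    obtain ⟨γ, h1, -⟩ := hclose _ _ _ _ α hα (h ξ hξ)
    rw [hone ξ γ heq.le h1] at h1
    exact absurd heq h1.ne
  have hlt : ∀ ξ ∈ closedHypDisc R, hypDist (σ ξ) (τ ξ) < η := by
    intro ξ hξ
    by_contra! hge
    obtain ⟨ζ, hζ, hζη⟩ := (isPreconnected_closedHypDisc R).intermediate_value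
      (zero_mem_closedHypDisc hR) hξ
      (continuous_hypDist_apply σ.continuous τ.continuous).continuousOn ⟨h0.le, hge⟩
    exact hne ζ hζ hζη
  refine ⟨hlt, fun ξ hξ α hα => ?_⟩
  obtain ⟨γ, h1, h2⟩ := hclose _ _ _ _ α hα (h ξ hξ)
  rw [hone ξ γ (hlt ξ hξ).le h1, map_one] at h2
  exact h2

variable [CompactSpace T]

/-- The centres are `[z, s]`, with `z` in a grid of mesh comparable to `exp (-R)` and `s` in the
transversally spanning set `S`. -/
theorem exists_cover_card_le (hΓ : IsSurfaceGroup Γ) (hι : Continuous ι)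
    (hu : ∀ x, IsLeafUniformization ρ x (u x)) {ε : ℝ} (hε : 0 < ε) :
    ∃ δ > 0, ∃ A r : ℝ, 0 ≤ A ∧ ∀ R ≥ 0, ∀ S : Finset T,
      (∀ t, ∃ s ∈ S, ¬ TransSep ρ (R + r) δ s t) →
      ∃ F : Finset (Suspension ρ), univ ⊆ ⋃ x ∈ F, bowenBall ι u R x ε ∧
        (F.card : ℝ) ≤ A * Real.exp (2 * R) * S.card := by
  classical
  obtain ⟨r, hr0, hcov⟩ := hΓ.exists_closedHypDisc
  obtain ⟨η, hη, hunif⟩ :=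
    exists_dist_lt_of_hypDist_lt hΓ.le_discAut hι r (half_pos hε)
  -- Chosen so that `4 * κ * exp r = min η 1 / 8`, which keeps the lifted leaves within `min η 1 /
  -- 2` of each other.
  set κ : ℝ := min η 1 / (32 * Real.exp r) with hκ
  have hm : 0 < min η 1 := lt_min hη one_pos
  have hκ0 : 0 < κ := by positivity
  have hκ1 : κ ≤ 1 := by
    rw [hκ, div_le_one (by positivity)]
    linarith [min_le_right η 1, Real.one_le_exp hr0]
  -- One `r` bounds `d_P(0, z)`, the other `d_P(0, α (σ ξ))`; together with `R` they bound the
  -- displacement of `0` by `α`.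
  refine ⟨η, hη, (5 / κ) ^ 2, r + r, by positivity, fun R hR S hS => ?_⟩
  have hs1 : κ * Real.exp (-R) ≤ 1 :=
    mul_le_one₀ hκ1 (Real.exp_pos _).le (Real.exp_le_one_iff.2 (by linarith))
  obtain ⟨Z, hZcard, hZ⟩ := exists_finset_forall_norm_sub_le (closedHypDisc r)
    (mul_pos hκ0 (Real.exp_pos (-R))) hs1
  refine ⟨(Z ×ˢ S).image fun p => Suspension.mk ρ p.1 p.2, fun y _ => ?_, ?_⟩
  · obtain ⟨⟨w₀, t₀⟩, rfl⟩ := Quotient.exists_rep y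
    obtain ⟨β, hβ⟩ := hcov w₀
    set w := (β : 𝔻 ≃ₜ 𝔻) w₀
    set t := ρ β t₀
    have hy : Suspension.mk ρ w t = Quotient.mk _ (w₀, t₀) := Suspension.mk_smul ρ β w₀ t₀
    rw [← hy]
    obtain ⟨z, hzZ, hzr, hzw⟩ := hZ w hβ
    obtain ⟨s, hsS, hst⟩ := hS t
    simp only [mem_iUnion]
    refine ⟨Suspension.mk ρ z s, Finset.mem_image_of_mem _ (Finset.mk_mem_product hzZ hsS), ?_⟩
    obtain ⟨σ, hσ, hσ0, hσu⟩ := (hu (Suspension.mk ρ z s)).exists_eq hΓ.le_discAut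
    obtain ⟨τ, hτ, hτ0, hτu⟩ := (hu (Suspension.mk ρ w t)).exists_eq hΓ.le_discAut
    obtain ⟨θ, hθ⟩ := exists_rotation_forall_norm_le hσ hτ
    refine mem_bowenBall_of_forall_dist_le (half_lt_self hε) hε θ fun ξ hξ => ?_
    obtain ⟨a, ha, haξ⟩ := hθ R ξ hξ
    obtain ⟨α, hα⟩ := hcov (σ ξ)
    rw [hσu, hτu]
    refine (hunif _ _ _ _ α hα ?_ ?_).le
    · have h1 : ‖(mob (-(σ 0)) (τ 0) : ℂ)‖ ≤ 2 * (κ * Real.exp (-R)) * Real.exp r := by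
        rw [hσ0, hτ0, norm_mob_neg]
        have h2 : Real.exp (-r) ≤ ‖1 - conj (z : ℂ) * w‖ := by
          refine (exp_neg_le_one_sub_norm hzr).trans ?_
          have h3 := norm_sub_norm_le (1 : ℂ) (conj (z : ℂ) * w)
          rw [norm_one, norm_mul, Complex.norm_conj] at h3
          nlinarith [norm_nonneg (z : ℂ), w.norm_lt_one]
        rw [div_le_iff₀ ((Real.exp_pos _).trans_le h2)]
        refine hzw.trans ?_
        rw [mul_assoc]
        refine le_mul_of_one_le_right (by positivity) ?_
        have h4 : Real.exp r * Real.exp (-r) = 1 := by rw [← Real.exp_add]; simp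
        rw [← h4]
        gcongr
      have h5 : ‖(a : ℂ)‖ ≤ min η 1 / 8 := by
        calc ‖(a : ℂ)‖ ≤ 2 * (2 * (κ * Real.exp (-R)) * Real.exp r) * Real.exp R :=
              ha.trans (by gcongr)
          _ = 4 * (κ * Real.exp r) * (Real.exp (-R) * Real.exp R) := by ring
          _ = 4 * (κ * Real.exp r) := by rw [← Real.exp_add]; simp
          _ = min η 1 / 8 := by rw [hκ]; field_simp; norm_num
      have h6 := min_le_left η 1
      have h7 := min_le_right η 1
      rw [haξ]
      have h8 := poincareDistZero_le_four_mul (z := a) (by linarith)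
      linarith
    · by_contra! hcon
      refine hst ⟨α, ?_, hcon⟩
      have h1 := poincareDistZero_le_add_hypDist ((α : 𝔻 ≃ₜ 𝔻) (σ ξ)) ((α : 𝔻 ≃ₜ 𝔻) 0)
      rw [hypDist_map (hΓ.mem_discAut α), hypDist_zero_right] at h1
      have h2 := hypDist_triangle (σ ξ) (σ 0) 0
      rw [hypDist_map hσ, hσ0, hypDist_zero_right, hypDist_zero_right, hypDist_zero_right] at h2
      rw [mem_closedHypDisc] at hα hξ hzr
      linarith
  · have h1 : (((Z ×ˢ S).image fun p => Suspension.mk ρ p.1 p.2).card : ℝ) ≤ Z.card * S.card := by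
      exact_mod_cast Finset.card_image_le.trans (Finset.card_product Z S).le
    refine h1.trans (mul_le_mul_of_nonneg_right (hZcard.trans (le_of_eq ?_)) (Nat.cast_nonneg _))
    have h2 : Real.exp (2 * R) * Real.exp (-R) ^ 2 = 1 := by
      rw [← Real.exp_nat_mul, ← Real.exp_add]
      simp
    rw [div_pow, div_pow, mul_pow, div_mul_eq_mul_div, div_eq_div_iff (by positivity)
      (by positivity)]
    linear_combination (-25 * κ ^ 2) * h2

/-- The points `[z, t]`, with `z` in a separated grid near `0` and `t ∈ S`, lie in distinct Bowen
balls of the cover: two in one ball would have lifts close on the whole disc. Radius `R + 1` allows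
for the base point `z` not being `0`. -/
theorem exists_le_card_cover (hΓ : IsSurfaceGroup Γ) (hι : IsEmbedding ι)
    (hu : ∀ x, IsLeafUniformization ρ x (u x)) {δ : ℝ} (hδ : 0 < δ) :
    ∃ ε > 0, ∃ c > 0, ∀ᶠ R : ℝ in atTop, ∀ S : Finset T, (S : Set T).Pairwise (TransSep ρ R δ) →
      ∀ F : Finset (Suspension ρ), univ ⊆ ⋃ x ∈ F, bowenBall ι u (R + 1) x ε →
        c * Real.exp (2 * R) * S.card ≤ F.card := by
  classical
  obtain ⟨r, hr0, hcov⟩ := hΓ.exists_closedHypDisc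
  obtain ⟨i, hi, hinj⟩ := hΓ.exists_le_hypDist
  -- The three bounds serve the transverse contradiction, the injectivity radius, and the estimate
  -- for automorphisms at distance at most `1`.
  set η : ℝ := min δ (min (i / 3) 1)
  have hη : 0 < η := lt_min hδ (lt_min (by positivity) one_pos)
  have hηδ : η ≤ δ := min_le_left _ _
  have hηi : 3 * η ≤ i := by
    linarith [(min_le_right δ (min (i / 3) 1)).trans (min_le_left _ _)]
  have hη1 : η ≤ 1 := (min_le_right _ _).trans (min_le_right _ _)
  obtain ⟨ε, hε, hclose⟩ := exists_hypDist_lt_of_dist_lt hΓ hι hcov hη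
  refine ⟨ε / 2, half_pos hε, (η / 12 / (4 * 9)) ^ 2, by positivity, ?_⟩
  have ht : Tendsto (fun R : ℝ => 4 * (9 * Real.exp (-(R + 1)))) atTop (𝓝 0) := by
    have h1 : Tendsto (fun R : ℝ => Real.exp (-(R + 1))) atTop (𝓝 0) :=
      Real.tendsto_exp_neg_atTop_nhds_zero.comp (tendsto_atTop_add_const_right _ 1 tendsto_id)
    simpa using (h1.const_mul 9).const_mul 4
  filter_upwards [ht.eventually_le_const (show (0 : ℝ) < η / 12 by positivity),
    eventually_ge_atTop 0] with R hsR hR S hS F hF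
  have hR1 : 0 ≤ R + 1 := by linarith
  -- Any constant above the `8` of `norm_sub_le_of_forall_hypDist_le` would do.
  set s := 9 * Real.exp (-(R + 1)) with hs
  obtain ⟨Z, hZn, hZs, hZc⟩ := exists_finset_separated (ρ := η / 12) (s := s)
    (by linarith) (by positivity) hsR
  have hball : ∀ y : Suspension ρ, ∃ x ∈ F, y ∈ bowenBall ι u (R + 1) x (ε / 2) := fun y => by
    simpa only [mem_iUnion, exists_prop] using hF (mem_univ y)
  choose ctr hctrF hctr using hball
  have hZd : ∀ z ∈ Z, poincareDistZero z ≤ η / 3 := fun z hz => by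
    have h1 := hZn z hz
    have h2 := poincareDistZero_le_four_mul (z := z) (by linarith)
    linarith
  have hcard : (Z ×ˢ S).card ≤ F.card := by
    refine Finset.card_le_card_of_injOn (fun p => ctr (Suspension.mk ρ p.1 p.2))
      (fun p _ => hctrF _) ?_
    rintro ⟨z, t⟩ hp ⟨w, t'⟩ hq hpq
    rw [Finset.mem_coe, Finset.mem_product] at hp hq
    obtain ⟨θ, hθ⟩ := exists_forall_dist_lt_of_mem_bowenBall (hctr (Suspension.mk ρ z t))
    obtain ⟨θ', hθ'⟩ := exists_forall_dist_lt_of_mem_bowenBall (hctr (Suspension.mk ρ w t'))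
    obtain ⟨σ, hσ, hσ0, hσu⟩ := (hu (Suspension.mk ρ z t)).exists_eq hΓ.le_discAut
    obtain ⟨τ, hτ, hτ0, hτu⟩ := (hu (Suspension.mk ρ w t')).exists_eq hΓ.le_discAut
    have hrot0 : ∀ c : Circle, rot c 0 = 0 := fun c =>
      Complex.UnitDisc.coe_injective (by simp [rot])
    have hσ' : (σ * rot (Circle.exp θ)) 0 = z := (congrArg σ (hrot0 _)).trans hσ0
    have hτ' : (τ * rot (Circle.exp θ')) 0 = w := (congrArg τ (hrot0 _)).trans hτ0
    obtain ⟨hd, hT⟩ := forall_hypDist_lt_of_forall_dist_lt (ρ := ρ) (s := t) (t := t') hR1 hcov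
      (fun γ hγ z => hηi.trans (hinj γ hγ z)) hclose
      (σ := σ * rot (Circle.exp θ)) (τ := τ * rot (Circle.exp θ')) (by
        rw [hσ', hτ']
        linarith [hypDist_le_add_poincareDistZero z w, hZd z hp.1, hZd w hq.1])
      (fun ξ hξ => by
        have h1 := hθ ξ hξ
        have h2 := hθ' ξ hξ
        rw [← show ctr (Suspension.mk ρ z t) = ctr (Suspension.mk ρ w t') from hpq, hτu] at h2
        rw [hσu] at h1
        refine (dist_triangle_left _ _ _).trans_lt ((add_lt_add h1 h2).trans_eq (add_halves ε)))
    have hmem := mul_mem hσ (rot_mem (Circle.exp θ))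
    have hzw : z = w := by
      refine hZs z hp.1 w hq.1 ?_
      have h1 := norm_sub_le_of_forall_hypDist_le hmem (mul_mem hτ (rot_mem (Circle.exp θ'))) hR1
        fun ξ hξ => (hd ξ hξ).le.trans hη1
      rw [hσ', hτ'] at h1
      linarith [Real.exp_pos (-(R + 1))]
    have htt : t = t' := by
      by_contra hne
      obtain ⟨α, hα, hαd⟩ := hS hp.2 hq.2 hne
      -- The parameter at which `α` carries the lifted leaf to `0`, so that `hT` controls `dist (ρ α
      -- t) (ρ α t')`.
      set ξ := (σ * rot (Circle.exp θ)).symm (((α⁻¹ : Γ) : 𝔻 ≃ₜ 𝔻) 0)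
      have hαξ : (α : 𝔻 ≃ₜ 𝔻) ((σ * rot (Circle.exp θ)) ξ) = 0 := by
        rw [Homeomorph.apply_symm_apply]
        exact (α : 𝔻 ≃ₜ 𝔻).apply_symm_apply 0
      have hξ : ξ ∈ closedHypDisc (R + 1) := by
        rw [mem_closedHypDisc, poincareDistZero_symm_apply hmem, hσ']
        have h1 := hypDist_le_add_poincareDistZero z (((α⁻¹ : Γ) : 𝔻 ≃ₜ 𝔻) 0)
        rw [poincareDistZero_inv_apply_zero hΓ.le_discAut] at h1
        linarith [hZd z hp.1]
      have h2 := hT ξ hξ α (by rw [hαξ]; exact zero_mem_closedHypDisc hr0)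
      linarith
    rw [hzw, htt]
  have h1 : (Z.card : ℝ) * S.card ≤ F.card := by
    rw [Finset.card_product] at hcard
    exact_mod_cast hcard
  refine le_trans (mul_le_mul_of_nonneg_right (le_trans ?_ hZc) (Nat.cast_nonneg _)) h1
  have h2 : η / 12 / (4 * s) = η / 12 / (4 * 9) * Real.exp (R + 1) := by
    rw [hs, Real.exp_neg]
    field_simp
  rw [h2, mul_pow]
  refine mul_le_mul_of_nonneg_left ?_ (by positivity)
  rw [← Real.exp_nat_mul]
  exact Real.exp_le_exp.2 (by push_cast; linarith)

/-- The entropy of a suspension is `2` plus the transverse growth rate. -/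
theorem hyperbolicEntropy_le_iff_transGrowth (hΓ : IsSurfaceGroup Γ) (hι : IsEmbedding ι)
    (hu : ∀ x, IsLeafUniformization ρ x (u x)) (a : ℝ) :
    hyperbolicEntropy ι u ≤ ((2 + a : ℝ) : EReal) ↔ TransGrowth ρ a := by
  rw [hyperbolicEntropy_le_coe_iff]
  constructor
  · intro h δ hδ b hb
    obtain ⟨ε, hε, c, hc, hcard⟩ := exists_le_card_cover hΓ hι hu hδ
    obtain ⟨b', hab', hb'⟩ := exists_between hb
    filter_upwards [hcard, (tendsto_atTop_add_const_right _ (1 : ℝ) tendsto_id).eventually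
      (h ε hε (2 + b') (by linarith)), eventually_const_mul_exp_le
      (c⁻¹ * Real.exp (2 + b')) hb'] with R hR hR' hR'' S hS
    obtain ⟨F, hF, hFcard⟩ := hR'
    have h1 := (hR S hS F hF).trans hFcard
    refine le_trans ?_ hR''
    have h2 : Real.exp ((2 + b') * (R + 1)) =
        Real.exp (2 * R) * (Real.exp (2 + b') * Real.exp (b' * R)) := by
      rw [← Real.exp_add, ← Real.exp_add]
      ring_nf
    rw [id, h2, mul_comm c, mul_assoc] at h1
    have h3 := le_of_mul_le_mul_left h1 (Real.exp_pos _)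
    rwa [mul_assoc, le_inv_mul_iff₀ hc]
  · intro h ε hε b hb
    obtain ⟨δ, hδ, A, r, hA, hcover⟩ := exists_cover_card_le hΓ hι.continuous hu hε
    obtain ⟨b', hab', hb'⟩ := exists_between (show a < b - 2 by linarith)
    filter_upwards [(tendsto_atTop_add_const_right _ r tendsto_id).eventually (h δ hδ b' hab'),
      eventually_const_mul_exp_le (A * Real.exp (b' * r)) (show 2 + b' < b by linarith),
      eventually_ge_atTop 0] with R hR hR' hR0
    obtain ⟨S, hS, hSmax⟩ := exists_maximal_pairwise (fun _ _ => TransSep.symm) hR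
    obtain ⟨F, hF, hFcard⟩ := hcover R hR0 S fun t => by
      obtain ⟨s, hs, hst⟩ := hSmax t
      refine ⟨s, hs, ?_⟩
      rcases hst with rfl | hst
      · rintro ⟨γ, -, hγ⟩
        rw [dist_self] at hγ
        linarith
      · exact hst
    refine ⟨F, hF, hFcard.trans (le_trans ?_ hR')⟩
    refine (mul_le_mul_of_nonneg_left (hR S hS) (by positivity)).trans (le_of_eq ?_)
    rw [id, mul_assoc, mul_assoc, ← Real.exp_add, ← Real.exp_add]
    ring_nf

theorem two_le_hyperbolicEntropy [Nonempty T] (hΓ : IsSurfaceGroup Γ) (hι : IsEmbedding ι)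
    (hu : ∀ x, IsLeafUniformization ρ x (u x)) : 2 ≤ hyperbolicEntropy ι u := by
  by_contra! hlt
  obtain ⟨c, hc, hc2⟩ := EReal.lt_iff_exists_real_btwn.1 hlt
  have h1 : c < 2 := EReal.coe_lt_coe_iff.1 hc2
  have h2 := (hyperbolicEntropy_le_iff_transGrowth hΓ hι hu (c - 2)).1 (by simpa using hc.le)
  linarith [h2.nonneg]

theorem hyperbolicEntropy_eq_two_iff (hΓ : IsSurfaceGroup Γ) (hι : IsEmbedding ι)
    (hu : ∀ x, IsLeafUniformization ρ x (u x)) :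
    hyperbolicEntropy ι u = 2 ↔ Nonempty T ∧ TransGrowth ρ 0 := by
  have h0 := hyperbolicEntropy_le_iff_transGrowth hΓ hι hu 0
  rw [add_zero] at h0
  constructor
  · intro h
    refine ⟨?_, h0.1 h.le⟩
    -- An empty `T` admits the growth rate `-1`, so the entropy would be at most 1.
    by_contra hT
    rw [not_nonempty_iff] at hT
    have h1 := (hyperbolicEntropy_le_iff_transGrowth hΓ hι hu (-1)).2 (TransGrowth.of_isEmpty _ _)
    rw [h] at h1
    have h2 : (2 : ℝ) ≤ 2 + -1 := EReal.coe_le_coe_iff.1 h1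
    linarith
  · rintro ⟨hT, h⟩
    exact le_antisymm (h0.2 h) (two_le_hyperbolicEntropy hΓ hι hu)

theorem hyperbolicEntropy_eq_top_iff (hΓ : IsSurfaceGroup Γ) (hι : IsEmbedding ι)
    (hu : ∀ x, IsLeafUniformization ρ x (u x)) :
    hyperbolicEntropy ι u = ⊤ ↔ ∀ a, ¬ TransGrowth ρ a := by
  constructor
  · intro h a ha
    have h1 := (hyperbolicEntropy_le_iff_transGrowth hΓ hι hu a).2 ha
    rw [h, top_le_iff] at h1
    exact EReal.coe_ne_top _ h1
  · intro h
    by_contra hne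
    obtain ⟨c, hc, -⟩ := EReal.lt_iff_exists_real_btwn.1 (lt_top_iff_ne_top.2 hne)
    exact h (c - 2) ((hyperbolicEntropy_le_iff_transGrowth hΓ hι hu (c - 2)).1
      (by simpa using hc.le))

end Suspension

end HypSusp

theorem mainTheorem9
    {Γ₁ Γ₂ : Subgroup (𝔻 ≃ₜ 𝔻)} (hΓ₁ : IsSurfaceGroup Γ₁) (hΓ₂ : IsSurfaceGroup Γ₂)
    {T₁ T₂ : Type*} [MetricSpace T₁] [CompactSpace T₁] [MetricSpace T₂] [CompactSpace T₂]
    (Φ : Surface Γ₁ ≃ₜ Surface Γ₂) (φ : Γ₁ ≃* Γ₂) (hΦ : Induces Φ φ) (Ψ : T₁ ≃ₜ T₂)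
    (ρ₁ : Γ₁ →* (T₁ ≃ₜ T₁)) (ρ₂ : Γ₂ →* (T₂ ≃ₜ T₂))
    (hρ : ∀ (γ : Γ₂) (t : T₂), ρ₂ γ t = Ψ (ρ₁ (φ.symm γ) (Ψ.symm t)))
    {M₁ M₂ : Type*} [MetricSpace M₁] [MetricSpace M₂]
    (ι₁ : Suspension ρ₁ → M₁) (hι₁ : IsEmbedding ι₁)
    (ι₂ : Suspension ρ₂ → M₂) (hι₂ : IsEmbedding ι₂)
    (u₁ : Suspension ρ₁ → 𝔻 → Suspension ρ₁) (hu₁ : ∀ x, IsLeafUniformization ρ₁ x (u₁ x))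
    (u₂ : Suspension ρ₂ → 𝔻 → Suspension ρ₂) (hu₂ : ∀ x, IsLeafUniformization ρ₂ x (u₂ x)) :
    (hyperbolicEntropy ι₁ u₁ = 2 ↔ hyperbolicEntropy ι₂ u₂ = 2) ∧
      (hyperbolicEntropy ι₁ u₁ = ⊤ ↔ hyperbolicEntropy ι₂ u₂ = ⊤) := by
  obtain ⟨F, -, hF⟩ := hΦ
  obtain ⟨L, hL⟩ := exists_transGrowth_of_conj hΓ₁.le_discAut hΓ₂ φ F hF Ψ ρ₁ ρ₂ hρ
  obtain ⟨L', hL'⟩ := exists_transGrowth_of_conj hΓ₂.le_discAut hΓ₁ φ.symm F.symm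
    (fun γ z => by rw [F.symm_apply_eq, hF]; simp) Ψ.symm ρ₂ ρ₁
    (fun γ t => by rw [hρ]; simp)
  rw [hyperbolicEntropy_eq_two_iff hΓ₁ hι₁ hu₁, hyperbolicEntropy_eq_two_iff hΓ₂ hι₂ hu₂,
    hyperbolicEntropy_eq_top_iff hΓ₁ hι₁ hu₁, hyperbolicEntropy_eq_top_iff hΓ₂ hι₂ hu₂]
  -- Rate zero is sent to `L * 0 = 0`, and a finite rate to a finite rate.
  refine ⟨and_congr Ψ.toEquiv.nonempty_congr ⟨fun h => ?_, fun h => ?_⟩,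
    fun h a ha => h _ (hL' a ha), fun h a ha => h _ (hL a ha)⟩
  · simpa using hL 0 h
  · simpa using hL' 0 h
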